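/- Fix $\alpha>0$. The Fock space $\mathcal F^2_\alpha$ is the space of entire functions $f$ with $\|f\|_2^2=\frac{\alpha}{\pi}\int_{\mathbb C}|f(z)|^2e^{-\alpha|z|^2}\,dm(z)<\infty$ ($m$ is Lebesgue measure on $\mathbb C$), with inner product $\langle f,g\rangle=\frac{\alpha}{\pi}\int_{\mathbb C}f(z)\overline{g(z)}e^{-\alpha|z|^2}\,dm(z)$. Put $e_k(z)=\sqrt{\alpha^k/k!}\,z^k$ for $k\ge 0$, and $T_wf(\zeta)=e^{\alpha\bar w\zeta-\frac{\alpha}{2}|w|^2}f(\zeta-w)$ for $w\in\mathbb C$. Let $D(z,r)$ be the open disc of centre $z$ and radius $r$. Let $X=\{(\lambda,m_\lambda)\}_{\lambda\in\Lambda}$ be a divisor, that is, a countable set $\Lambda\subset\mathbb C$ together with a multiplicity $m_\lambda\in\{1,2,\dots\}$ for each $\lambda\in\Lambda$. $X$ is called sampling for $\mathcal F^2_\alpha$ if there are constants $A,B>0$ such that $$A\|f\|_2^2\le\sum_{\lambda\in\Lambda}\sum_{k=0}^{m_\lambda-1}|\langle f,T_\lambda e_k\rangle|^2\le B\|f\|_2^2\qquad\text{for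 all } f\in\mathcal F^2_\alpha,$$ and $X$ satisfies the finite overlap condition if $\sup_{z\in\mathbb C}\sum_{\lambda\in\Lambda}\chi_{D(\lambda,\sqrt{m_\lambda/\alpha})}(z)<\infty$. (a) If $X$ is sampling for $\mathcal F^2_\alpha$, then $X$ satisfies the finite overlap condition and there exists $C>0$ such that $\bigcup_{\lambda\in\Lambda}D(\lambda,\sqrt{m_\lambda/\alpha}+C)=\mathbb C$. (b) Conversely, if $X$ satisfies the finite overlap condition and for every $C>0$ there is a compact set $K\subset\mathbb C$ such that $\bigcup_{\lambda\in\Lambda,\,m_\lambda>\alpha C^2}D(\lambda,\sqrt{m_\lambda/\alpha}-C)=\mathbb C\setminus K$, then $X$ is sampling for $\mathcal F^2_\alpha$. -/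

import Mathlib

open MeasureTheory
open scoped ENNReal ComplexConjugate

noncomputable section

namespace Fock

/-- The squared norm `(α/π) ∫ |f(z)|² exp(-α|z|²) dm(z)`, as an extended nonnegative real. -/
def normSq (α : ℝ) (f : ℂ → ℂ) : ℝ≥0∞ :=
  ENNReal.ofReal (α / Real.pi) *
    ∫⁻ z : ℂ, ‖f z‖ₑ ^ 2 * ENNReal.ofReal (Real.exp (-α * ‖z‖ ^ 2))

/-- Membership in the Fock space: `f` is entire and has finite norm. -/
def MemFock (α : ℝ) (f : ℂ → ℂ) : Prop :=
  Differentiable ℂ f ∧ normSq α f < ⊤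

/-- The inner product `⟨f, g⟩ = (α/π) ∫ f(z) conj(g(z)) exp(-α|z|²) dm(z)`,
used for `f`, `g` in the Fock space, where the integrand is integrable. -/
def innerProd (α : ℝ) (f g : ℂ → ℂ) : ℂ :=
  ((α / Real.pi : ℝ) : ℂ) *
    ∫ z : ℂ, f z * conj (g z) * ((Real.exp (-α * ‖z‖ ^ 2) : ℝ) : ℂ)

/-- The orthonormal basis of normalized monomials `e_k(z) = √(α^k) / √(k!) z^k`. -/
def basisFun (α : ℝ) (k : ℕ) (z : ℂ) : ℂ :=
  ((Real.sqrt (α ^ k) / Real.sqrt (k.factorial : ℝ) : ℝ) : ℂ) * z ^ k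

/-- The translation `T_w f(ζ) = exp(α conj(w) ζ - (α/2)|w|²) f(ζ - w)`. -/
def translate (α : ℝ) (w : ℂ) (f : ℂ → ℂ) (ζ : ℂ) : ℂ :=
  Complex.exp ((α : ℂ) * conj w * ζ - ((α / 2 * ‖w‖ ^ 2 : ℝ) : ℂ)) * f (ζ - w)

/-- A divisor: a countable set of points of `ℂ`, each with a positive integer multiplicity. -/
structure PlaneDivisor where
  /-- the underlying set of points -/
  support : Set ℂ
  countable_support : support.Countable
  /-- the multiplicity of each point -/
  mult : support → ℕ
  mult_pos : ∀ l, 0 < mult l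

namespace PlaneDivisor

/-- The radius `√(m_λ/α)` attached to a point of the divisor. -/
def radius (X : PlaneDivisor) (α : ℝ) (l : X.support) : ℝ :=
  Real.sqrt ((X.mult l : ℝ) / α)

/-- The sum `∑_{λ} ∑_{k < m_λ} |⟨f, T_λ e_k⟩|²`, with values in `[0, ∞]`. -/
def sampleSum (X : PlaneDivisor) (α : ℝ) (f : ℂ → ℂ) : ℝ≥0∞ :=
  ∑' l : X.support, ∑ k ∈ Finset.range (X.mult l),
    ‖innerProd α f (translate α (l : ℂ) (basisFun α k))‖ₑ ^ 2

/-- `X` is sampling: `‖f‖²` and the sampling sum are comparable, uniformly in `f`. -/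
def IsSampling (X : PlaneDivisor) (α : ℝ) : Prop :=
  ∃ A B : ℝ, 0 < A ∧ 0 < B ∧ ∀ f : ℂ → ℂ, MemFock α f →
    ENNReal.ofReal A * normSq α f ≤ X.sampleSum α f ∧
      X.sampleSum α f ≤ ENNReal.ofReal B * normSq α f

/-- The finite overlap condition: `sup_z ∑_λ χ_{D(λ, √(m_λ/α))}(z) < ∞`. -/
def FiniteOverlap (X : PlaneDivisor) (α : ℝ) : Prop :=
  (⨆ z : ℂ, ∑' l : X.support,
    (Metric.ball (l : ℂ) (X.radius α l)).indicator (fun _ => (1 : ℝ≥0∞)) z) < ⊤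

end PlaneDivisor

end Fock

end

/-! ### The Gaussian measure and the Fock translations. -/

namespace Fock

open Filter Topology

/-! Everything rests on two explicit computations. Since translations are unitary with adjoint
`T_{-w}`, the numbers `⟨f, T_λ e_k⟩` are the normalized Taylor coefficients of `T_{-λ} f`. The
monomials are orthogonal on every centred disc, so the Gaussian mass of `|f|²` on `D(λ, s)` is `∑_k
|⟨f, T_λ e_k⟩|²` weighted by the mass of `|e_k|²` in `D(0, s)` (`MemFock.setLIntegral_ball`). On the
other hand, for the normalized kernel `T_z e_0` the squared coefficients at `λ` are Poisson
probabilities of parameter `α|z-λ|²` (`enorm_innerProd_kernel`).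

Necessity tests the sampling inequality on the kernels. If `z ∈ D(λ, √(m_λ/α))`, the Poisson
parameter is at most `m_λ` and the first `m_λ` probabilities add up to at least `1/(4e)`
(`poissonHead_ge`); the upper sampling bound therefore limits the number of such `λ`. If `z` has
distance at least `C` from all the discs, a Chernoff bound (`poissonHead_le`) and the finite overlap
just obtained dominate the sampling sum by a Gaussian tail beyond `C`, which contradicts the lower
bound for large `C`.

For sufficiency, monomials with `k < m_λ` keep a fixed proportion of their mass in the disc of
radius `√(m_λ/α)` (`exists_monomialMass_ge`), which gives the upper bound. Those with `k ≥ m_λ - 1`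
lose almost all of their mass there when the disc is shrunk by a large constant
(`monomialMass_shrink`). Summing over the shrunken discs, which cover the plane off a compact set,
and absorbing the small error gives `‖f‖² ≤ 2(mass of f on a fixed disc + sampling sum)`, even with
all multiplicities lowered by one (`PlaneDivisor.exists_normSq_le`).

The mass on the fixed disc is removed by compactness, provided that a function with zero sampling
sum vanishes. That is where the spare multiplicity is spent: `n` remote simple zeros of such an `f`
are moved to the origin. The new function still has zero lowered sum, so its norm is controlled by
the fixed disc, where the factor `z^n` is small; comparison at a point well outside that disc yields
a bound on `f` that decays like `4^{-n}`. -/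

/-- The Gaussian probability measure `(α/π) exp(-α|z|²) dm(z)` on the plane. -/
noncomputable def gaussianMeasure (α : ℝ) : Measure ℂ :=
  ENNReal.ofReal (α / Real.pi) •
    (volume : Measure ℂ).withDensity (fun z => ENNReal.ofReal (Real.exp (-α * ‖z‖ ^ 2)))

lemma measurable_gaussian_density (α : ℝ) :
    Measurable (fun z : ℂ => ENNReal.ofReal (Real.exp (-α * ‖z‖ ^ 2))) := by
  fun_prop

lemma lintegral_gaussianMeasure (α : ℝ) (F : ℂ → ℝ≥0∞) :
    ∫⁻ z, F z ∂gaussianMeasure α =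
      ENNReal.ofReal (α / Real.pi) *
        ∫⁻ z, F z * ENNReal.ofReal (Real.exp (-α * ‖z‖ ^ 2)) := by
  rw [gaussianMeasure, lintegral_smul_measure,
    lintegral_withDensity_eq_lintegral_mul_non_measurable _ (measurable_gaussian_density α)
      (by simp)]
  simp [mul_comm]

lemma normSq_eq (α : ℝ) (f : ℂ → ℂ) :
    normSq α f = ∫⁻ z, ‖f z‖ₑ ^ 2 ∂gaussianMeasure α := by
  rw [normSq, lintegral_gaussianMeasure]

lemma innerProd_eq {α : ℝ} (hα : 0 < α) (f g : ℂ → ℂ) :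
    innerProd α f g = ∫ z, f z * conj (g z) ∂gaussianMeasure α := by
  rw [innerProd, gaussianMeasure, integral_smul_measure,
    integral_withDensity_eq_integral_toReal_smul (measurable_gaussian_density α) (by simp),
    ENNReal.toReal_ofReal (by positivity), Complex.real_smul]
  congr 2
  ext z
  rw [ENNReal.toReal_ofReal (by positivity), Complex.real_smul]
  ring

lemma setLIntegral_gaussianMeasure (α : ℝ) (F : ℂ → ℝ≥0∞) {s : Set ℂ} (hs : MeasurableSet s) :
    ∫⁻ z in s, F z ∂gaussianMeasure α =
      ENNReal.ofReal (α / Real.pi) *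
        ∫⁻ z in s, F z * ENNReal.ofReal (Real.exp (-α * ‖z‖ ^ 2)) := by
  rw [← lintegral_indicator hs, lintegral_gaussianMeasure, ← lintegral_indicator hs]
  congr 2
  ext z
  by_cases hz : z ∈ s <;> simp [hz]

/-- The exponential factor of the translation exactly compensates the change of Gaussian weight. All
isometry statements below come from this pointwise identity and translation invariance of Lebesgue
measure. -/
lemma enorm_translate_sq_mul (α : ℝ) (w : ℂ) (f : ℂ → ℂ) (z : ℂ) :
    ‖translate α (-w) f z‖ₑ ^ 2 * ENNReal.ofReal (Real.exp (-α * ‖z‖ ^ 2)) =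
      ‖f (z + w)‖ₑ ^ 2 * ENNReal.ofReal (Real.exp (-α * ‖z + w‖ ^ 2)) := by
  simp only [translate, ← ofReal_norm]
  rw [← ENNReal.ofReal_pow (norm_nonneg _), ← ENNReal.ofReal_pow (norm_nonneg _),
    ← ENNReal.ofReal_mul (by positivity), ← ENNReal.ofReal_mul (by positivity)]
  congr 1
  rw [norm_mul, Complex.norm_exp, mul_pow, sub_neg_eq_add, ← Real.exp_nat_mul, mul_right_comm,
    ← Real.exp_add, mul_comm]
  congr 2
  simp only [Complex.sq_norm, Complex.normSq_apply]
  simp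
  ring

lemma setLIntegral_translate (α : ℝ) (w : ℂ) (f : ℂ → ℂ) (s : ℝ) :
    ∫⁻ z in Metric.ball w s, ‖f z‖ₑ ^ 2 ∂gaussianMeasure α =
      ∫⁻ z in Metric.ball 0 s, ‖translate α (-w) f z‖ₑ ^ 2 ∂gaussianMeasure α := by
  rw [setLIntegral_gaussianMeasure _ _ measurableSet_ball,
    setLIntegral_gaussianMeasure _ _ measurableSet_ball]
  congr 1
  simp_rw [enorm_translate_sq_mul]
  rw [← lintegral_indicator measurableSet_ball, ← lintegral_indicator measurableSet_ball,
    ← lintegral_add_right_eq_self _ w]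
  congr 1
  ext z
  simp [Set.indicator, dist_eq_norm]

lemma normSq_translate (α : ℝ) (w : ℂ) (f : ℂ → ℂ) :
    normSq α (translate α (-w) f) = normSq α f := by
  unfold normSq
  simp_rw [enorm_translate_sq_mul]
  rw [lintegral_add_right_eq_self (fun z : ℂ => ‖f z‖ₑ ^ 2 *
    ENNReal.ofReal (Real.exp (-α * ‖z‖ ^ 2))) w]

lemma innerProd_translate (α : ℝ) (w : ℂ) (f g : ℂ → ℂ) :
    innerProd α f (translate α w g) = innerProd α (translate α (-w) f) g := by
  unfold innerProd
  congr 1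
  rw [← integral_add_right_eq_self _ w]
  congr 1
  ext z
  simp only [translate, map_mul, sub_neg_eq_add, add_sub_cancel_right, ← Complex.exp_conj,
    Complex.ofReal_exp]
  have : ∀ a b c d e x y : ℂ, a + b = c + d →
      x * (Complex.exp a * y) * Complex.exp b = Complex.exp c * x * y * Complex.exp d := by
    intro a b c d e x y h
    calc _ = x * y * (Complex.exp a * Complex.exp b) := by ring
      _ = x * y * (Complex.exp c * Complex.exp d) := by rw [← Complex.exp_add, h, Complex.exp_add]
      _ = _ := by ring
  apply this _ _ _ _ 0
  simp only [Complex.ofReal_mul, Complex.ofReal_neg, Complex.ofReal_pow, ← Complex.conj_mul',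
    map_sub, map_mul, map_add, Complex.conj_conj, Complex.conj_ofReal, norm_neg, map_neg]
  simp only [Complex.ofReal_div, Complex.ofReal_ofNat]
  ring

lemma differentiable_translate (α : ℝ) (w : ℂ) {f : ℂ → ℂ} (hf : Differentiable ℂ f) :
    Differentiable ℂ (translate α w f) := by
  unfold translate
  fun_prop

lemma MemFock.translate {α : ℝ} {f : ℂ → ℂ} (hf : MemFock α f) (w : ℂ) :
    MemFock α (translate α w f) := by
  refine ⟨differentiable_translate α w hf.1, ?_⟩
  have := normSq_translate α (-w) f
  rw [neg_neg] at this
  rw [this]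
  exact hf.2

/-! ### Monomials on centred discs. -/

lemma lintegral_comp_norm {F : ℝ → ℝ≥0∞} (hF : Measurable F) :
    ∫⁻ z : ℂ, F ‖z‖ =
      ENNReal.ofReal (2 * Real.pi) * ∫⁻ r in Set.Ioi (0 : ℝ), ENNReal.ofReal r * F r := by
  rw [← Complex.lintegral_comp_polarCoord_symm, polarCoord_target, Measure.volume_eq_prod,
    setLIntegral_prod]
  · rw [← lintegral_const_mul _ (by fun_prop)]
    refine setLIntegral_congr_fun measurableSet_Ioi fun r hr => ?_
    have hr' : 0 < r := hr
    simp only [Complex.norm_polarCoord_symm, smul_eq_mul, abs_of_pos hr']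
    rw [setLIntegral_const, Real.volume_Ioo, mul_comm]
    congr 2
    ring
  · simp only [Complex.norm_polarCoord_symm, smul_eq_mul]
    fun_prop

/-- The mass of `‖e_k‖²` in the centred disc of radius `s`. -/
noncomputable def monomialMass (α : ℝ) (k : ℕ) (s : ℝ) : ℝ≥0∞ :=
  ∫⁻ z in Metric.ball 0 s, ‖basisFun α k z‖ₑ ^ 2 ∂gaussianMeasure α

/-- The radial density `r^(2k+1) exp(-αr²)`. -/
noncomputable def radialDensity (α : ℝ) (k : ℕ) (r : ℝ) : ℝ :=
  r ^ (2 * k + 1) * Real.exp (-α * r ^ 2)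

lemma enorm_basisFun_sq {α : ℝ} (hα : 0 < α) (k : ℕ) (z : ℂ) :
    ‖basisFun α k z‖ₑ ^ 2 = ENNReal.ofReal (α ^ k / k.factorial * ‖z‖ ^ (2 * k)) := by
  rw [← ofReal_norm, ← ENNReal.ofReal_pow (norm_nonneg _), basisFun, norm_mul,
    Complex.norm_real, Real.norm_of_nonneg (by positivity), mul_pow, div_pow,
    Real.sq_sqrt (by positivity), Real.sq_sqrt (by positivity), norm_pow, ← pow_mul, mul_comm k]

lemma monomialMass_eq {α : ℝ} (hα : 0 < α) (k : ℕ) (s : ℝ) :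
    monomialMass α k s = ENNReal.ofReal (2 * α * (α ^ k / k.factorial)) *
      ∫⁻ r in Set.Ioo 0 s, ENNReal.ofReal (radialDensity α k r) := by
  rw [monomialMass, setLIntegral_gaussianMeasure _ _ measurableSet_ball,
    ← lintegral_indicator measurableSet_ball]
  have h1 : ∀ z : ℂ, (Metric.ball (0 : ℂ) s).indicator (fun z => ‖basisFun α k z‖ₑ ^ 2 *
      ENNReal.ofReal (Real.exp (-α * ‖z‖ ^ 2))) z =
      (fun r : ℝ => (Set.Iio s).indicator (fun r => ENNReal.ofReal
        (α ^ k / k.factorial * r ^ (2 * k) * Real.exp (-α * r ^ 2))) r) ‖z‖ := by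
    intro z
    simp only [Set.indicator, Metric.mem_ball, dist_zero_right, Set.mem_Iio]
    split_ifs
    · rw [enorm_basisFun_sq hα, ← ENNReal.ofReal_mul (by positivity)]
    · rfl
  simp_rw [h1]
  rw [lintegral_comp_norm (Measurable.indicator (by fun_prop) measurableSet_Iio), ← mul_assoc,
    ← ENNReal.ofReal_mul (by positivity)]
  have h2 : ∀ r ∈ Set.Ioi (0 : ℝ), ENNReal.ofReal r * (Set.Iio s).indicator (fun r => ENNReal.ofReal
        (α ^ k / k.factorial * r ^ (2 * k) * Real.exp (-α * r ^ 2))) r =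
        (Set.Iio s).indicator (fun r => ENNReal.ofReal (α ^ k / k.factorial) *
          ENNReal.ofReal (radialDensity α k r)) r := by
    intro r hr
    have hr' : 0 < r := hr
    simp only [Set.indicator]
    split_ifs
    · rw [← ENNReal.ofReal_mul (by positivity), ← ENNReal.ofReal_mul (by positivity),
        radialDensity]
      congr 1
      ring
    · simp
  rw [setLIntegral_congr_fun measurableSet_Ioi h2, lintegral_indicator measurableSet_Iio,
    Measure.restrict_restrict measurableSet_Iio, Set.inter_comm, Set.Ioi_inter_Iio,
    lintegral_const_mul _ (by unfold radialDensity; fun_prop), ← mul_assoc,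
    ← ENNReal.ofReal_mul (by positivity)]
  congr 2
  field_simp

lemma lintegral_basisFun {α : ℝ} (hα : 0 < α) (k : ℕ) :
    ∫⁻ z, ‖basisFun α k z‖ₑ ^ 2 ∂gaussianMeasure α = 1 := by
  rw [lintegral_gaussianMeasure]
  have h : ∀ z : ℂ, ‖basisFun α k z‖ₑ ^ 2 * ENNReal.ofReal (Real.exp (-α * ‖z‖ ^ 2)) =
      ENNReal.ofReal (α ^ k / k.factorial * (‖z‖ ^ (2 * k) * Real.exp (-α * ‖z‖ ^ 2))) := by
    intro z
    rw [enorm_basisFun_sq hα, ← ENNReal.ofReal_mul (by positivity), mul_assoc]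
  have hI := Complex.integral_rpow_mul_exp_neg_mul_rpow (p := 2) (q := (2 * k : ℕ)) (b := α)
    (by norm_num) (by have : (0 : ℝ) ≤ (2 * k : ℕ) := by positivity
                      linarith) hα
  have hI2 : ∫ z : ℂ, ‖z‖ ^ (2 * k) * Real.exp (-α * ‖z‖ ^ 2) =
      Real.pi * k.factorial / α ^ (k + 1) := by
    have h3 : (((2 * k : ℕ) : ℝ) + 2) / 2 = ((k + 1 : ℕ) : ℝ) := by push_cast; ring
    have h4 : -((((2 * k : ℕ) : ℝ) + 2) / 2) = -((k + 1 : ℕ) : ℝ) := by rw [h3]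
    rw [neg_div, h4, h3] at hI
    simp only [Real.rpow_natCast, Real.rpow_two, Real.rpow_neg hα.le] at hI
    rw [hI]
    push_cast
    rw [Real.Gamma_nat_eq_factorial]
    ring
  have hpos : 0 < ∫ z : ℂ, ‖z‖ ^ (2 * k) * Real.exp (-α * ‖z‖ ^ 2) := by
    rw [hI2]; positivity
  -- The Bochner integral of a nonintegrable function is `0` by convention, so a positive value
  -- proves integrability.
  have hint : Integrable (fun z : ℂ => ‖z‖ ^ (2 * k) * Real.exp (-α * ‖z‖ ^ 2)) := by
    by_contra hn
    rw [integral_undef hn] at hpos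
    exact lt_irrefl _ hpos
  simp_rw [h]
  rw [← ofReal_integral_eq_lintegral_ofReal (hint.const_mul _)
    (Eventually.of_forall fun z => by positivity), integral_const_mul, hI2,
    ← ENNReal.ofReal_mul (by positivity), ← ENNReal.ofReal_one]
  congr 1
  field_simp
  ring

lemma isProbabilityMeasure_gaussianMeasure {α : ℝ} (hα : 0 < α) :
    IsProbabilityMeasure (gaussianMeasure α) := by
  refine ⟨?_⟩
  have h := lintegral_basisFun hα 0
  simpa [basisFun] using h

lemma integral_rotation (α : ℝ) (ω : Circle) (s : ℝ) (F : ℂ → ℂ) :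
    ∫ z in Metric.ball 0 s, F (ω * z) ∂gaussianMeasure α =
      ∫ z in Metric.ball 0 s, F z ∂gaussianMeasure α := by
  have hmp : MeasurePreserving (rotation ω) (gaussianMeasure α) (gaussianMeasure α) := by
    refine ⟨(rotation ω).continuous.measurable, ?_⟩
    ext t ht
    rw [Measure.map_apply (rotation ω).continuous.measurable ht, ← lintegral_indicator_one ht,
      ← lintegral_indicator_one ((rotation ω).continuous.measurable ht),
      lintegral_gaussianMeasure, lintegral_gaussianMeasure]
    conv_rhs => rw [← (rotation ω).measurePreserving.lintegral_comp_emb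
        (rotation ω).toHomeomorph.measurableEmbedding]
    congr 2
    ext z
    simp [Set.indicator, -rotation_apply]
    rfl
  have h := hmp.setIntegral_preimage_emb (rotation ω).toHomeomorph.measurableEmbedding F
    (Metric.ball 0 s)
  have hb : rotation ω ⁻¹' Metric.ball 0 s = Metric.ball 0 s := by
    ext z
    rw [Set.mem_preimage, mem_ball_zero_iff, mem_ball_zero_iff, LinearIsometryEquiv.norm_map]
  rw [hb] at h
  simpa using h

lemma exists_circle_pow_ne {j k : ℕ} (h : j ≠ k) : ∃ ω : Circle, (ω : ℂ) ^ j ≠ (ω : ℂ) ^ k := by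
  wlog hjk : j < k generalizing j k
  · obtain ⟨ω, hω⟩ := this h.symm (by omega)
    exact ⟨ω, hω.symm⟩
  -- With this choice `ω^(k-j) = -1`.
  refine ⟨Circle.exp (Real.pi / (k - j : ℕ)), fun he => ?_⟩
  obtain ⟨d, rfl⟩ := Nat.exists_eq_add_of_lt hjk
  have hne : ((Circle.exp (Real.pi / (j + d + 1 - j : ℕ)) : Circle) : ℂ) ^ j ≠ 0 :=
    pow_ne_zero _ (Circle.coe_ne_zero _)
  rw [add_assoc, pow_add] at he
  have h1 : ((Circle.exp (Real.pi / (j + (d + 1) - j : ℕ)) : Circle) : ℂ) ^ (d + 1) = 1 := by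
    have := mul_left_cancel₀ hne ((mul_one _).trans he)
    exact this.symm
  rw [Circle.coe_exp, ← Complex.exp_nat_mul, Nat.add_sub_cancel_left] at h1
  have h2 : ((d + 1 : ℕ) : ℂ) * (((Real.pi / (d + 1 : ℕ) : ℝ) : ℂ) * Complex.I) =
      Real.pi * Complex.I := by
    push_cast
    have : (d : ℂ) + 1 ≠ 0 := by exact_mod_cast Nat.succ_ne_zero d
    field_simp
  rw [h2, Complex.exp_pi_mul_I] at h1
  norm_num at h1

lemma continuous_basisFun (α : ℝ) (k : ℕ) : Continuous (basisFun α k) := by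
  unfold basisFun
  fun_prop

/-- The disc and the measure are invariant under rotation by `ω`, while the integrand is multiplied
by `ω^j conj(ω^k)`. When this factor is not `1` the integral must vanish. -/
lemma integral_basisFun_orthogonal {α : ℝ} {j k : ℕ} (h : j ≠ k) (s : ℝ) :
    ∫ z in Metric.ball 0 s, basisFun α j z * conj (basisFun α k z) ∂gaussianMeasure α = 0 := by
  obtain ⟨ω, hω⟩ := exists_circle_pow_ne h
  have h1 := integral_rotation α ω s (fun z => basisFun α j z * conj (basisFun α k z))
  have h2 : ∀ z : ℂ, basisFun α j (ω * z) * conj (basisFun α k (ω * z)) =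
      ((ω : ℂ) ^ j * conj ((ω : ℂ) ^ k)) * (basisFun α j z * conj (basisFun α k z)) := by
    intro z
    simp only [basisFun, mul_pow, map_mul]
    ring
  simp_rw [h2] at h1
  rw [integral_const_mul] at h1
  by_contra hne
  have h3 : (ω : ℂ) ^ j * conj ((ω : ℂ) ^ k) = 1 := mul_right_cancel₀ hne (by rw [h1, one_mul])
  apply hω
  have h4 : (ω : ℂ) ^ k * conj ((ω : ℂ) ^ k) = 1 := by
    rw [Complex.mul_conj', norm_pow, Circle.norm_coe]
    simp
  calc (ω : ℂ) ^ j = (ω : ℂ) ^ j * ((ω : ℂ) ^ k * conj ((ω : ℂ) ^ k)) := by rw [h4, mul_one]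
    _ = ((ω : ℂ) ^ j * conj ((ω : ℂ) ^ k)) * (ω : ℂ) ^ k := by ring
    _ = _ := by rw [h3, one_mul]

lemma norm_basisFun_le {α : ℝ} {k : ℕ} {z : ℂ} {s : ℝ} (hz : ‖z‖ ≤ s) :
    ‖basisFun α k z‖ ≤ ‖basisFun α k s‖ := by
  simp only [basisFun, norm_mul, norm_pow, Complex.norm_real]
  gcongr
  exact hz.trans (le_abs_self s)

lemma integrableOn_ball_of_continuous {α : ℝ} (hα : 0 < α) {F : ℂ → ℂ} (hF : Continuous F)
    (s : ℝ) : IntegrableOn F (Metric.ball 0 s) (gaussianMeasure α) := by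
  have := isProbabilityMeasure_gaussianMeasure hα
  exact (hF.continuousOn.integrableOn_compact (isCompact_closedBall 0 s)).mono_set
    Metric.ball_subset_closedBall

lemma integrableOn_ball_of_continuous_real {α : ℝ} (hα : 0 < α) {F : ℂ → ℝ} (hF : Continuous F)
    (s : ℝ) : IntegrableOn F (Metric.ball 0 s) (gaussianMeasure α) := by
  have := isProbabilityMeasure_gaussianMeasure hα
  exact (hF.continuousOn.integrableOn_compact (isCompact_closedBall 0 s)).mono_set
    Metric.ball_subset_closedBall

lemma setLIntegral_enorm_sq {α : ℝ} (hα : 0 < α) {F : ℂ → ℂ} (hF : Continuous F) (s : ℝ) :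
    ∫⁻ z in Metric.ball 0 s, ‖F z‖ₑ ^ 2 ∂gaussianMeasure α =
      ENNReal.ofReal (∫ z in Metric.ball 0 s, F z * conj (F z) ∂gaussianMeasure α).re := by
  have h1 : ∀ z, F z * conj (F z) = ((‖F z‖ ^ 2 : ℝ) : ℂ) := by
    intro z; rw [Complex.mul_conj']; norm_cast
  simp_rw [h1]
  rw [integral_complex_ofReal, Complex.ofReal_re,
    ofReal_integral_eq_lintegral_ofReal
      (integrableOn_ball_of_continuous_real hα (by fun_prop) s)
      (Eventually.of_forall fun z => by positivity)]
  refine lintegral_congr fun z => ?_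
  rw [ENNReal.ofReal_pow (norm_nonneg _), ofReal_norm]

lemma setLIntegral_partialSum {α : ℝ} (hα : 0 < α) (c : ℕ → ℂ) (s : ℝ) (n : ℕ) :
    ∫⁻ z in Metric.ball 0 s, ‖∑ k ∈ Finset.range n, c k * basisFun α k z‖ₑ ^ 2
        ∂gaussianMeasure α =
      ∑ k ∈ Finset.range n, ‖c k‖ₑ ^ 2 * monomialMass α k s := by
  have hcont : ∀ k, Continuous (basisFun α k) := continuous_basisFun α
  have hnn : ∀ k, 0 ≤ (∫ z in Metric.ball 0 s, basisFun α k z * conj (basisFun α k z)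
      ∂gaussianMeasure α).re := by
    intro k
    have h1 : ∀ z, basisFun α k z * conj (basisFun α k z) = ((‖basisFun α k z‖ ^ 2 : ℝ) : ℂ) := by
      intro z; rw [Complex.mul_conj']; norm_cast
    simp_rw [h1]
    rw [integral_complex_ofReal, Complex.ofReal_re]
    exact integral_nonneg fun z => by positivity
  rw [setLIntegral_enorm_sq hα (by fun_prop)]
  have h2 : ∀ z, (∑ k ∈ Finset.range n, c k * basisFun α k z) *
      conj (∑ k ∈ Finset.range n, c k * basisFun α k z) =
      ∑ k ∈ Finset.range n, ∑ j ∈ Finset.range n,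
        (c k * conj (c j)) * (basisFun α k z * conj (basisFun α j z)) := by
    intro z
    rw [map_sum, Finset.sum_mul_sum]
    refine Finset.sum_congr rfl fun k _ => Finset.sum_congr rfl fun j _ => ?_
    rw [map_mul]; ring
  simp_rw [h2]
  have hint : ∀ k j, IntegrableOn (fun z => (c k * conj (c j)) *
      (basisFun α k z * conj (basisFun α j z))) (Metric.ball 0 s) (gaussianMeasure α) :=
    fun k j => integrableOn_ball_of_continuous hα
      (continuous_const.mul ((hcont k).mul (Complex.continuous_conj.comp (hcont j)))) s
  rw [integral_finsetSum _ fun k _ => integrable_finsetSum _ fun j _ => hint k j]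
  simp_rw [integral_finsetSum _ fun j _ => hint _ j, integral_const_mul]
  have h3 : ∀ k ∈ Finset.range n, ∑ j ∈ Finset.range n, c k * conj (c j) *
      ∫ z in Metric.ball 0 s, basisFun α k z * conj (basisFun α j z) ∂gaussianMeasure α =
      ((‖c k‖ ^ 2 : ℝ) : ℂ) *
        ∫ z in Metric.ball 0 s, basisFun α k z * conj (basisFun α k z) ∂gaussianMeasure α := by
    intro k hk
    rw [Finset.sum_eq_single_of_mem k hk, Complex.mul_conj']
    · norm_cast
    · intro j _ hj
      rw [integral_basisFun_orthogonal hj.symm, mul_zero]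
  rw [Finset.sum_congr rfl h3, Complex.re_sum, ENNReal.ofReal_sum_of_nonneg]
  · refine Finset.sum_congr rfl fun k _ => ?_
    rw [Complex.re_ofReal_mul, ENNReal.ofReal_mul (by positivity), monomialMass,
      setLIntegral_enorm_sq hα (hcont k), ENNReal.ofReal_pow (norm_nonneg _), ofReal_norm]
  · intro k _
    rw [Complex.re_ofReal_mul]
    exact mul_nonneg (by positivity) (hnn k)

/-! ### Expansions in normalized monomials and Parseval identities. -/

/-- `g = ∑ c_k e_k` pointwise. -/
def HasExpansion (α : ℝ) (c : ℕ → ℂ) (g : ℂ → ℂ) : Prop :=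
  ∀ z, HasSum (fun k => c k * basisFun α k z) (g z)

lemma HasExpansion.summable_norm {α : ℝ} {c : ℕ → ℂ} {g : ℂ → ℂ} (h : HasExpansion α c g)
    (z : ℂ) : Summable fun k => ‖c k * basisFun α k z‖ :=
  (h z).summable.norm

lemma HasExpansion.differentiable {α : ℝ} {c : ℕ → ℂ} {g : ℂ → ℂ} (h : HasExpansion α c g) :
    Differentiable ℂ g := by
  have hg : g = fun z => ∑' k, c k * basisFun α k z := funext fun z => (h z).tsum_eq.symm
  intro z
  have hd : DifferentiableOn ℂ g (Metric.ball 0 (‖z‖ + 1)) := by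
    rw [hg]
    refine Complex.differentiableOn_tsum_of_summable_norm
      (h.summable_norm ((‖z‖ + 1 : ℝ) : ℂ)) (fun k => ?_) Metric.isOpen_ball fun k w hw => ?_
    · unfold basisFun
      fun_prop
    · rw [norm_mul, norm_mul]
      gcongr
      exact norm_basisFun_le (by simpa using (mem_ball_zero_iff.mp hw).le)
  exact hd.differentiableAt (Metric.isOpen_ball.mem_nhds (by simp))

/-- Parseval on a disc: orthogonality settles the partial sums, and on the disc these are dominated
by the convergent sum of the absolute terms at the radius. -/
lemma HasExpansion.setLIntegral {α : ℝ} (hα : 0 < α) {c : ℕ → ℂ} {g : ℂ → ℂ}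
    (h : HasExpansion α c g) (s : ℝ) :
    ∫⁻ z in Metric.ball 0 s, ‖g z‖ₑ ^ 2 ∂gaussianMeasure α =
      ∑' k, ‖c k‖ₑ ^ 2 * monomialMass α k s := by
  have := isProbabilityMeasure_gaussianMeasure hα
  have hcont : ∀ k, Continuous (basisFun α k) := continuous_basisFun α
  have hlim : Tendsto (fun n => ∫⁻ z in Metric.ball 0 s,
      ‖∑ k ∈ Finset.range n, c k * basisFun α k z‖ₑ ^ 2 ∂gaussianMeasure α) atTop
      (𝓝 (∫⁻ z in Metric.ball 0 s, ‖g z‖ₑ ^ 2 ∂gaussianMeasure α)) := by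
    refine tendsto_lintegral_of_dominated_convergence
      (fun _ => ENNReal.ofReal (∑' k, ‖c k * basisFun α k s‖) ^ 2)
      (fun n => ?_) (fun n => ?_) ?_ ?_
    · have : Continuous fun z => ∑ k ∈ Finset.range n, c k * basisFun α k z := by fun_prop
      exact this.measurable.enorm.pow_const 2
    · filter_upwards [ae_restrict_mem measurableSet_ball] with z hz
      rw [← ofReal_norm]
      gcongr
      refine (norm_sum_le _ _).trans ((Finset.sum_le_sum fun k _ => ?_).trans
        ((h.summable_norm s).sum_le_tsum _ fun k _ => norm_nonneg _))
      rw [norm_mul, norm_mul]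
      gcongr
      exact norm_basisFun_le (mem_ball_zero_iff.mp hz).le
    · rw [lintegral_const]
      exact ENNReal.mul_ne_top (by simp) (measure_ne_top _ _)
    · refine Eventually.of_forall fun z => ?_
      exact ((((ENNReal.continuous_pow 2).comp continuous_enorm).tendsto _).comp (h z).tendsto_sum_nat)
  simp_rw [setLIntegral_partialSum hα] at hlim
  exact tendsto_nhds_unique hlim (ENNReal.tendsto_nat_tsum _)

lemma iUnion_ball_nat : ⋃ n : ℕ, Metric.ball (0 : ℂ) n = Set.univ := by
  exact Metric.iUnion_ball_nat 0

lemma tendsto_setLIntegral_ball {μ : Measure ℂ} (F : ℂ → ℝ≥0∞) :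
    Tendsto (fun n : ℕ => ∫⁻ z in Metric.ball 0 (n : ℝ), F z ∂μ) atTop (𝓝 (∫⁻ z, F z ∂μ)) := by
  have hm : Monotone fun n : ℕ => Metric.ball (0 : ℂ) n :=
    fun a b hab => Metric.ball_subset_ball (by exact_mod_cast hab)
  have h := tendsto_atTop_iSup (f := fun n : ℕ => ∫⁻ z in Metric.ball 0 (n : ℝ), F z ∂μ)
    (fun a b hab => lintegral_mono_set (hm hab))
  rwa [← setLIntegral_iUnion_of_directed F hm.directed_le, iUnion_ball_nat, Measure.restrict_univ]
    at h

lemma monomialMass_mono (α : ℝ) (k : ℕ) : Monotone (monomialMass α k) :=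
  fun _ _ h => lintegral_mono_set (Metric.ball_subset_ball h)

lemma tendsto_monomialMass {α : ℝ} (hα : 0 < α) (k : ℕ) :
    Tendsto (fun n : ℕ => monomialMass α k n) atTop (𝓝 1) := by
  rw [← lintegral_basisFun hα k]
  exact tendsto_setLIntegral_ball _

lemma monomialMass_le_one {α : ℝ} (hα : 0 < α) (k : ℕ) (s : ℝ) : monomialMass α k s ≤ 1 := by
  rw [← lintegral_basisFun hα k]
  exact setLIntegral_le_lintegral _ _

lemma HasExpansion.normSq {α : ℝ} (hα : 0 < α) {c : ℕ → ℂ} {g : ℂ → ℂ}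
    (h : HasExpansion α c g) : normSq α g = ∑' k, ‖c k‖ₑ ^ 2 := by
  rw [normSq_eq]
  have h1 := tendsto_setLIntegral_ball (μ := gaussianMeasure α) fun z => ‖g z‖ₑ ^ 2
  simp_rw [h.setLIntegral hα] at h1
  have hm : ∀ k, Monotone fun n : ℕ => ‖c k‖ₑ ^ 2 * monomialMass α k n := fun k a b hab => by
    dsimp only
    gcongr
    exact monomialMass_mono α k (by exact_mod_cast hab)
  have h2 : Tendsto (fun n : ℕ => ∑' k, ‖c k‖ₑ ^ 2 * monomialMass α k n) atTop
      (𝓝 (∑' k, ‖c k‖ₑ ^ 2)) := by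
    have h3 : ∀ k, Tendsto (fun n : ℕ => ‖c k‖ₑ ^ 2 * monomialMass α k n) atTop
        (𝓝 (‖c k‖ₑ ^ 2)) := fun k => by
      simpa using ENNReal.Tendsto.const_mul (tendsto_monomialMass hα k) (Or.inl one_ne_zero)
    simp_rw [← lintegral_count]
    -- The series is read as an integral for the counting measure, so monotone convergence applies
    -- as the disc exhausts the plane.
    exact lintegral_tendsto_of_tendsto_of_monotone (fun n => measurable_from_top.aemeasurable)
      (Eventually.of_forall fun k => hm k) (Eventually.of_forall fun k => h3 k)
  exact tendsto_nhds_unique h1 h2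

lemma memLp_two_of_memFock {α : ℝ} {f : ℂ → ℂ} (hf : MemFock α f) :
    MemLp f 2 (gaussianMeasure α) := by
  refine ⟨hf.1.continuous.aestronglyMeasurable, ?_⟩
  have := hf.2
  rw [normSq_eq] at this
  rw [eLpNorm_lt_top_iff_lintegral_rpow_enorm_lt_top (by norm_num) (by norm_num)]
  simpa using this

lemma memFock_basisFun {α : ℝ} (hα : 0 < α) (k : ℕ) : MemFock α (basisFun α k) := by
  refine ⟨by unfold basisFun; fun_prop, ?_⟩
  rw [normSq_eq, lintegral_basisFun hα]
  exact ENNReal.one_lt_top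

lemma MemFock.integrable_mul_conj {α : ℝ} {f g : ℂ → ℂ} (hf : MemFock α f) (hg : MemFock α g) :
    Integrable (fun z => f z * conj (g z)) (gaussianMeasure α) := by
  have h1 := memLp_two_of_memFock hf
  have h2 := (memLp_two_of_memFock hg).star
  exact MemLp.integrable_mul h1 h2

lemma HasExpansion.setIntegral_mul_conj {α : ℝ} (hα : 0 < α) {c : ℕ → ℂ} {g : ℂ → ℂ}
    (h : HasExpansion α c g) (k : ℕ) (s : ℝ) :
    ∫ z in Metric.ball 0 s, g z * conj (basisFun α k z) ∂gaussianMeasure α =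
      c k * ∫ z in Metric.ball 0 s, basisFun α k z * conj (basisFun α k z)
        ∂gaussianMeasure α := by
  have := isProbabilityMeasure_gaussianMeasure hα
  have hcont : ∀ k, Continuous (basisFun α k) := continuous_basisFun α
  have hlim : Tendsto (fun n => ∫ z in Metric.ball 0 s,
      (∑ j ∈ Finset.range n, c j * basisFun α j z) * conj (basisFun α k z) ∂gaussianMeasure α)
      atTop (𝓝 (∫ z in Metric.ball 0 s, g z * conj (basisFun α k z) ∂gaussianMeasure α)) := by
    refine tendsto_integral_of_dominated_convergence
      (fun _ => (∑' k, ‖c k * basisFun α k s‖) * ‖basisFun α k s‖) (fun n => ?_) ?_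
      (fun n => ?_) ?_
    · have hc : Continuous fun z => (∑ j ∈ Finset.range n, c j * basisFun α j z) *
          conj (basisFun α k z) :=
        (continuous_finsetSum _ fun j _ => continuous_const.mul (hcont j)).mul
          (Complex.continuous_conj.comp (hcont k))
      exact hc.aestronglyMeasurable
    · exact integrable_const _
    · filter_upwards [ae_restrict_mem measurableSet_ball] with z hz
      have hz' := (mem_ball_zero_iff.mp hz).le
      rw [norm_mul, RCLike.norm_conj]
      refine mul_le_mul ?_ (norm_basisFun_le hz') (norm_nonneg _)
        (tsum_nonneg fun _ => norm_nonneg _)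
      refine (norm_sum_le _ _).trans ((Finset.sum_le_sum fun k _ => ?_).trans
        ((h.summable_norm s).sum_le_tsum _ fun k _ => norm_nonneg _))
      rw [norm_mul, norm_mul]
      gcongr
      exact norm_basisFun_le hz'
    · exact Eventually.of_forall fun z => (h z).tendsto_sum_nat.mul_const _
  refine tendsto_nhds_unique hlim (tendsto_const_nhds.congr' ?_)
  filter_upwards [eventually_gt_atTop k] with n hn
  simp_rw [Finset.sum_mul, mul_assoc]
  have hint : ∀ j, IntegrableOn (fun z => c j * (basisFun α j z * conj (basisFun α k z)))
      (Metric.ball 0 s) (gaussianMeasure α) := fun j => integrableOn_ball_of_continuous hα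
    (continuous_const.mul ((hcont j).mul (Complex.continuous_conj.comp (hcont k)))) s
  rw [integral_finsetSum _ fun j _ => hint j]
  simp_rw [integral_const_mul]
  rw [Finset.sum_eq_single_of_mem k (Finset.mem_range.mpr hn)]
  intro j _ hj
  rw [integral_basisFun_orthogonal hj, mul_zero]

lemma HasExpansion.innerProd_basisFun {α : ℝ} (hα : 0 < α) {c : ℕ → ℂ} {g : ℂ → ℂ}
    (h : HasExpansion α c g) (hg : MemFock α g) (k : ℕ) :
    innerProd α g (basisFun α k) = c k := by
  have hcont : ∀ k, Continuous (basisFun α k) := continuous_basisFun α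
  rw [innerProd_eq hα]
  have hm : Monotone fun n : ℕ => Metric.ball (0 : ℂ) n :=
    fun a b hab => Metric.ball_subset_ball (by exact_mod_cast hab)
  have hlim : ∀ F : ℂ → ℂ, Integrable F (gaussianMeasure α) →
      Tendsto (fun n : ℕ => ∫ z in Metric.ball 0 (n : ℝ), F z ∂gaussianMeasure α) atTop
        (𝓝 (∫ z, F z ∂gaussianMeasure α)) := by
    intro F hF
    have := tendsto_setIntegral_of_monotone (fun n : ℕ => measurableSet_ball) hm
      (f := F) (μ := gaussianMeasure α) (hF.integrableOn)
    rwa [iUnion_ball_nat, Measure.restrict_univ] at this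
  have h1 := hlim _ (hg.integrable_mul_conj (memFock_basisFun hα k))
  simp_rw [h.setIntegral_mul_conj hα] at h1
  have h2 := (hlim _ ((memFock_basisFun hα k).integrable_mul_conj
    (memFock_basisFun hα k))).const_mul (c k)
  rw [tendsto_nhds_unique h1 h2]
  have h3 : ∀ z, basisFun α k z * conj (basisFun α k z) = ((‖basisFun α k z‖ ^ 2 : ℝ) : ℂ) := by
    intro z; rw [Complex.mul_conj']; norm_cast
  have h4 : ∫ z, ‖basisFun α k z‖ ^ 2 ∂gaussianMeasure α = 1 := by
    have hc : Continuous fun z => ‖basisFun α k z‖ ^ 2 := by fun_prop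
    rw [integral_eq_lintegral_of_nonneg_ae (Eventually.of_forall fun z => sq_nonneg _)
      hc.aestronglyMeasurable, ← ENNReal.toReal_one,
      ← lintegral_basisFun hα k]
    congr 1
    refine lintegral_congr fun z => ?_
    rw [ENNReal.ofReal_pow (norm_nonneg _), ofReal_norm]
  simp_rw [h3]
  rw [integral_complex_ofReal, h4]
  simp

lemma exists_hasExpansion {α : ℝ} (hα : 0 < α) {g : ℂ → ℂ} (hg : Differentiable ℂ g) :
    HasExpansion α (fun k => iteratedDeriv k g 0 / k.factorial /
      ((Real.sqrt (α ^ k) / Real.sqrt (k.factorial : ℝ) : ℝ) : ℂ)) g := by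
  intro z
  have h := Complex.hasSum_taylorSeries_of_entire hg 0 z
  refine h.congr_fun fun k => ?_
  have hne : ((Real.sqrt (α ^ k) / Real.sqrt (k.factorial : ℝ) : ℝ) : ℂ) ≠ 0 := by
    have : 0 < Real.sqrt (α ^ k) / Real.sqrt (k.factorial : ℝ) := by
      have : 0 < k.factorial := k.factorial_pos
      positivity
    exact_mod_cast this.ne'
  simp only [basisFun, sub_zero, smul_eq_mul]
  field_simp

/-- The Taylor series supplies some expansion of this kind, and testing against `e_k` identifies its
coefficients. -/
lemma MemFock.hasExpansion {α : ℝ} (hα : 0 < α) {g : ℂ → ℂ} (hg : MemFock α g) :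
    HasExpansion α (fun k => innerProd α g (basisFun α k)) g := by
  have h := exists_hasExpansion hα hg.1
  have h2 := h.innerProd_basisFun hα hg
  simp_rw [h2]
  exact h

/-! ### Radial mass of monomials near the critical radius. -/

lemma measurable_radialDensity (α : ℝ) (k : ℕ) : Measurable (radialDensity α k) := by
  unfold radialDensity
  fun_prop

/-- Below its peak the density increases at a Gaussian rate. Moving outwards by `h`, with a further
margin `h` below `R`, already gains the factor `exp(5αh² - 1)`. -/
lemma radialDensity_le_shift {α : ℝ} (hα : 0 < α) {k : ℕ} {R h u : ℝ} (hk : α * R ^ 2 ≤ k + 1)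
    (hh : 0 < h) (hu : 0 < u) (huR : u + 2 * h ≤ R) :
    radialDensity α k u ≤ Real.exp (1 - 5 * α * h ^ 2) * radialDensity α k (u + h) := by
  set x := h / (u + h) with hx
  have hx1 : x ≤ 1 := by rw [hx, div_le_one (by positivity)]; linarith
  have hxm : x * (u + h) = h := by rw [hx]; field_simp
  have hx0 : 0 < x := by positivity
  have h1 : u ≤ Real.exp (-x) * (u + h) := by
    have : 1 - x ≤ Real.exp (-x) := by linarith [Real.add_one_le_exp (-x)]
    calc u = (1 - x) * (u + h) := by rw [sub_mul, hxm]; ring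
      _ ≤ _ := by gcongr
  have h2 : u ^ (2 * k + 1) ≤ Real.exp (-((2 * k + 1 : ℕ) * x)) * (u + h) ^ (2 * k + 1) := by
    calc u ^ (2 * k + 1) ≤ (Real.exp (-x) * (u + h)) ^ (2 * k + 1) := by gcongr
      _ = _ := by rw [mul_pow, ← Real.exp_nat_mul, mul_neg]
  -- The product equals `(u + 2h)² - h²`.
  have h3 : (u + h) * (u + 3 * h) ≤ R ^ 2 := by nlinarith
  have h4 : 2 * α * h * (u + 3 * h) - x ≤ (2 * k + 1) * x := by
    have h5 : α * ((u + h) * (u + 3 * h)) ≤ k + 1 := (mul_le_mul_of_nonneg_left h3 hα.le).trans hk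
    have h6 := mul_le_mul_of_nonneg_right h5 hx0.le
    have h7 : α * ((u + h) * (u + 3 * h)) * x = α * (u + 3 * h) * h := by
      rw [show α * ((u + h) * (u + 3 * h)) * x = α * (u + 3 * h) * (x * (u + h)) by ring, hxm]
    rw [h7] at h6
    linarith
  unfold radialDensity
  calc u ^ (2 * k + 1) * Real.exp (-α * u ^ 2)
      ≤ (Real.exp (-((2 * k + 1 : ℕ) * x)) * (u + h) ^ (2 * k + 1)) * Real.exp (-α * u ^ 2) := by
        gcongr
    _ = (u + h) ^ (2 * k + 1) * Real.exp (-((2 * k + 1 : ℕ) * x) + -α * u ^ 2) := by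
        rw [Real.exp_add]; ring
    _ ≤ (u + h) ^ (2 * k + 1) * Real.exp ((1 - 5 * α * h ^ 2) + -α * (u + h) ^ 2) := by
        refine mul_le_mul_of_nonneg_left (Real.exp_le_exp.mpr ?_) (by positivity)
        push_cast
        nlinarith
    _ = _ := by rw [Real.exp_add]; ring

/-- Shrinking a disc of radius `R` by `2h` decreases the mass of high monomials by a factor
that tends to `0` as `h → ∞`, uniformly in `R`. -/
lemma monomialMass_shrink {α : ℝ} (hα : 0 < α) {k : ℕ} {R h : ℝ} (hk : α * R ^ 2 ≤ k + 1)
    (hh : 0 < h) :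
    monomialMass α k (R - 2 * h) ≤
      ENNReal.ofReal (Real.exp (1 - 5 * α * h ^ 2)) * monomialMass α k R := by
  rw [monomialMass_eq hα, monomialMass_eq hα, mul_left_comm]
  gcongr
  rw [← lintegral_const_mul _ (measurable_radialDensity α k).ennreal_ofReal]
  calc ∫⁻ u in Set.Ioo 0 (R - 2 * h), ENNReal.ofReal (radialDensity α k u)
      ≤ ∫⁻ u in Set.Ioo 0 (R - 2 * h), ENNReal.ofReal (Real.exp (1 - 5 * α * h ^ 2)) *
          ENNReal.ofReal (radialDensity α k (u + h)) := by
        refine setLIntegral_mono' measurableSet_Ioo fun u hu => ?_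
        rw [← ENNReal.ofReal_mul (by positivity)]
        exact ENNReal.ofReal_le_ofReal
          (radialDensity_le_shift hα hk hh hu.1 (by linarith [hu.2]))
    _ ≤ ∫⁻ u, (Set.Ioo 0 R).indicator (fun u => ENNReal.ofReal (Real.exp (1 - 5 * α * h ^ 2)) *
          ENNReal.ofReal (radialDensity α k u)) (u + h) := by
        rw [← lintegral_indicator measurableSet_Ioo]
        refine lintegral_mono fun u => ?_
        by_cases hu : u ∈ Set.Ioo 0 (R - 2 * h)
        · have hu' : u + h ∈ Set.Ioo 0 R := ⟨by linarith [hu.1], by linarith [hu.2]⟩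
          rw [Set.indicator_of_mem hu, Set.indicator_of_mem hu']
        · rw [Set.indicator_of_notMem hu]
          exact zero_le
    _ = _ := by
        rw [lintegral_add_right_eq_self (fun u => (Set.Ioo 0 R).indicator
          (fun u => ENNReal.ofReal (Real.exp (1 - 5 * α * h ^ 2)) *
          ENNReal.ofReal (radialDensity α k u)) u) h, lintegral_indicator measurableSet_Ioo]

/-- When `k + 1 ≤ αR²` the peak lies inside radius `R`. Bounding `r/R` by `exp(r/R - 1)` leaves a
pure Gaussian decay beyond `R`. -/
lemma radialDensity_le_gaussian {α : ℝ} {k : ℕ} {R r : ℝ} (hk : k + 1 ≤ α * R ^ 2)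
    (hR : 0 < R) (hr : R ≤ r) :
    radialDensity α k r ≤ radialDensity α k R * Real.exp (-α * (r - R) ^ 2) := by
  set x := (r - R) / R with hx
  have hx0 : 0 ≤ x := div_nonneg (by linarith) hR.le
  have hxm : x * R = r - R := by rw [hx]; field_simp
  have h1 : r ^ (2 * k + 1) ≤ Real.exp ((2 * k + 1 : ℕ) * x) * R ^ (2 * k + 1) := by
    rw [Real.exp_nat_mul, ← mul_pow]
    have : r = (x + 1) * R := by rw [add_mul, hxm]; ring
    have h2 : r ≤ Real.exp x * R := by
      rw [this]
      gcongr
      exact Real.add_one_le_exp x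
    have : 0 < r := by linarith
    gcongr
  have h2 : (2 * k + 1) * x ≤ 2 * α * R * (r - R) := by
    have := mul_le_mul_of_nonneg_right hk hx0
    have h3 : α * R ^ 2 * x = α * R * (r - R) := by rw [← hxm]; ring
    nlinarith
  unfold radialDensity
  calc r ^ (2 * k + 1) * Real.exp (-α * r ^ 2)
      ≤ Real.exp ((2 * k + 1 : ℕ) * x) * R ^ (2 * k + 1) * Real.exp (-α * r ^ 2) := by gcongr
    _ = R ^ (2 * k + 1) * Real.exp ((2 * k + 1 : ℕ) * x + -α * r ^ 2) := by
        rw [Real.exp_add]; ring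
    _ ≤ R ^ (2 * k + 1) * Real.exp (-α * R ^ 2 + -α * (r - R) ^ 2) := by
        refine mul_le_mul_of_nonneg_left (Real.exp_le_exp.mpr ?_) (by positivity)
        push_cast
        linarith
    _ = _ := by rw [Real.exp_add]; ring

/-- A companion to the tail bound: within distance `1/(2√α)` inside `R` the density is still
comparable to its value at `R`. The loss in the exponent is `5α(R - r)² ≤ 5/4`. -/
lemma radialDensity_ge {α : ℝ} {k : ℕ} {R r : ℝ} (hk : k + 1 ≤ α * R ^ 2)
    (hR : 0 < R) (hr : r ≤ R) (hr2 : R / 2 ≤ r) (hr3 : α * (R - r) ^ 2 ≤ 1 / 4) :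
    Real.exp (-5 / 4) * radialDensity α k R ≤ radialDensity α k r := by
  set y := (R - r) / R with hy
  have hy0 : 0 ≤ y := div_nonneg (by linarith) hR.le
  have hym : y * R = R - r := by rw [hy]; field_simp
  have hy1 : y ≤ 1 / 2 := by rw [hy, div_le_iff₀ hR]; linarith
  have h1 : Real.exp (-(y + 2 * y ^ 2)) ≤ 1 - y := by
    have h2 : (1 - y)⁻¹ ≤ Real.exp (y + 2 * y ^ 2) := by
      refine le_trans ?_ (Real.add_one_le_exp _)
      rw [inv_le_iff_one_le_mul₀ (by linarith)]
      nlinarith [mul_nonneg (sq_nonneg y) (sub_nonneg.mpr hy1)]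
    rw [Real.exp_neg]
    exact inv_le_of_inv_le₀ (by linarith) h2
  have h3 : Real.exp (-((2 * k + 1 : ℕ) * (y + 2 * y ^ 2))) * R ^ (2 * k + 1) ≤
      r ^ (2 * k + 1) := by
    rw [← mul_neg, Real.exp_nat_mul, ← mul_pow]
    have : r = (1 - y) * R := by rw [sub_mul, hym]; ring
    gcongr
    rw [this]
    gcongr
  have h4 : (2 * k + 1) * (y + 2 * y ^ 2) ≤ 2 * α * R * (R - r) + 4 * α * (R - r) ^ 2 := by
    have h5 : 0 ≤ y + 2 * y ^ 2 := by positivity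
    have := mul_le_mul_of_nonneg_right hk h5
    have h6 : α * R ^ 2 * (y + 2 * y ^ 2) = α * R * (R - r) + 2 * α * (R - r) ^ 2 := by
      rw [← hym]; ring
    nlinarith
  unfold radialDensity
  calc Real.exp (-5 / 4) * (R ^ (2 * k + 1) * Real.exp (-α * R ^ 2))
      = R ^ (2 * k + 1) * Real.exp (-5 / 4 + -α * R ^ 2) := by rw [Real.exp_add]; ring
    _ ≤ R ^ (2 * k + 1) * Real.exp (-((2 * k + 1 : ℕ) * (y + 2 * y ^ 2)) + -α * r ^ 2) := by
        refine mul_le_mul_of_nonneg_left (Real.exp_le_exp.mpr ?_) (by positivity)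
        push_cast
        nlinarith
    _ = Real.exp (-((2 * k + 1 : ℕ) * (y + 2 * y ^ 2))) * R ^ (2 * k + 1) *
          Real.exp (-α * r ^ 2) := by rw [Real.exp_add]; ring
    _ ≤ _ := by gcongr

/-- Low monomials have a fixed proportion of their mass in the disc of radius `R`. -/
lemma exists_monomialMass_ge {α : ℝ} (hα : 0 < α) :
    ∃ B : ℝ, 0 < B ∧ ∀ (k : ℕ) (R : ℝ), 0 < R → k + 1 ≤ α * R ^ 2 →
      1 ≤ ENNReal.ofReal B * monomialMass α k R := by
  set h := 1 / (2 * Real.sqrt α) with hh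
  have hsα : 0 < Real.sqrt α := Real.sqrt_pos.mpr hα
  have hsq : Real.sqrt α ^ 2 = α := Real.sq_sqrt hα.le
  have hh0 : 0 < h := by positivity
  have hαh : α * h ^ 2 = 1 / 4 := by
    rw [hh, div_pow, mul_pow, hsq]; field_simp; norm_num
  set G := Real.sqrt (Real.pi / α) with hG
  have hG0 : 0 < G := Real.sqrt_pos.mpr (by positivity)
  -- The tail beyond `R` is at most `G` times the density at `R`, and the window of width `h` inside
  -- `R` carries at least `h e^{-5/4}` times that density. So the total mass is at most this
  -- constant times the mass inside.
  refine ⟨1 + G / (h * Real.exp (-5 / 4)), by positivity, fun k R hR hk => ?_⟩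
  set I := ∫⁻ r in Set.Ioo 0 R, ENNReal.ofReal (radialDensity α k r) with hI
  have hφR : 0 ≤ radialDensity α k R := by unfold radialDensity; positivity
  have hhR : h ≤ R / 2 := by
    by_contra hcon
    push Not at hcon
    have : α * (R / 2) ^ 2 < α * h ^ 2 := by gcongr
    have hk0 : (0 : ℝ) ≤ k := k.cast_nonneg
    nlinarith
  have hlow : ENNReal.ofReal (h * Real.exp (-5 / 4) * radialDensity α k R) ≤ I := by
    calc ENNReal.ofReal (h * Real.exp (-5 / 4) * radialDensity α k R)
        = ∫⁻ r in Set.Ioo (R - h) R, ENNReal.ofReal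
            (Real.exp (-5 / 4) * radialDensity α k R) := by
          rw [setLIntegral_const, Real.volume_Ioo, ← ENNReal.ofReal_mul (by positivity)]
          congr 1; ring
      _ ≤ ∫⁻ r in Set.Ioo (R - h) R, ENNReal.ofReal (radialDensity α k r) := by
          refine setLIntegral_mono' measurableSet_Ioo fun r hr => ENNReal.ofReal_le_ofReal ?_
          refine radialDensity_ge hk hR hr.2.le (by linarith [hr.1]) ?_
          rw [← hαh]
          have : 0 ≤ R - r := by linarith [hr.2]
          gcongr
          linarith [hr.1]
      _ ≤ I := lintegral_mono_set (Set.Ioo_subset_Ioo_left (by linarith))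
  have htail : ∫⁻ r in Set.Ici R, ENNReal.ofReal (radialDensity α k r) ≤
      ENNReal.ofReal (radialDensity α k R * G) := by
    calc ∫⁻ r in Set.Ici R, ENNReal.ofReal (radialDensity α k r)
        ≤ ∫⁻ r in Set.Ici R, ENNReal.ofReal
            (radialDensity α k R * Real.exp (-α * (r - R) ^ 2)) :=
          setLIntegral_mono' measurableSet_Ici fun r hr =>
            ENNReal.ofReal_le_ofReal (radialDensity_le_gaussian hk hR hr)
      _ ≤ ∫⁻ r, ENNReal.ofReal (radialDensity α k R * Real.exp (-α * (r - R) ^ 2)) :=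
          setLIntegral_le_lintegral _ _
      _ = ∫⁻ r, ENNReal.ofReal (radialDensity α k R * Real.exp (-α * r ^ 2)) :=
          lintegral_sub_right_eq_self
            (fun r => ENNReal.ofReal (radialDensity α k R * Real.exp (-α * r ^ 2))) R
      _ = _ := by
          rw [← ofReal_integral_eq_lintegral_ofReal
            ((integrable_exp_neg_mul_sq hα).const_mul _)
            (Eventually.of_forall fun r => by positivity), integral_const_mul, integral_gaussian]
  have htail2 : ENNReal.ofReal (radialDensity α k R * G) ≤
      ENNReal.ofReal (G / (h * Real.exp (-5 / 4))) * I := by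
    refine le_trans (le_of_eq ?_) (mul_le_mul_right hlow _)
    rw [← ENNReal.ofReal_mul (by positivity)]
    congr 1
    field_simp
  refine le_of_tendsto (tendsto_monomialMass hα k) (Eventually.of_forall fun n => ?_)
  rw [monomialMass_eq hα, monomialMass_eq hα, mul_left_comm, ← hI]
  gcongr
  calc ∫⁻ r in Set.Ioo 0 (n : ℝ), ENNReal.ofReal (radialDensity α k r)
      ≤ ∫⁻ r in Set.Ioo 0 R ∪ Set.Ici R, ENNReal.ofReal (radialDensity α k r) := by
        refine lintegral_mono_set fun r hr => ?_
        rcases lt_or_ge r R with h | h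
        · exact Or.inl ⟨hr.1, h⟩
        · exact Or.inr h
    _ ≤ I + ENNReal.ofReal (G / (h * Real.exp (-5 / 4))) * I :=
        (lintegral_union_le _ _ _).trans (add_le_add le_rfl (htail.trans htail2))
    _ = _ := by
        rw [ENNReal.ofReal_add zero_le_one (by positivity), ENNReal.ofReal_one, add_mul, one_mul]

/-! ### Estimates for Poisson distribution functions. -/

/-- The probability that a Poisson variable of parameter `t` is less than `m`. -/
noncomputable def poissonHead (m : ℕ) (t : ℝ) : ℝ :=
  ∑ k ∈ Finset.range m, Real.exp (-t) * (t ^ k / k.factorial)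

/-- Differentiating termwise, consecutive terms telescope and only the last survives; its sign gives
monotonicity in `t`. -/
lemma hasDerivAt_poissonHead (m : ℕ) (t : ℝ) :
    HasDerivAt (poissonHead (m + 1)) (-(Real.exp (-t) * (t ^ m / m.factorial))) t := by
  have hexp : HasDerivAt (fun t : ℝ => Real.exp (-t)) (-Real.exp (-t)) t := by
    simpa using (hasDerivAt_neg t).exp
  induction m with
  | zero =>
    have : poissonHead (0 + 1) = fun t => Real.exp (-t) := by
      ext t; simp [poissonHead]
    rw [this]
    simpa using hexp
  | succ m ih =>
    have h1 : poissonHead (m + 1 + 1) = fun t => poissonHead (m + 1) t +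
        Real.exp (-t) * (t ^ (m + 1) / (m + 1).factorial) := by
      ext t; simp [poissonHead, Finset.sum_range_succ]
    rw [h1]
    have h2 := ih.fun_add (hexp.fun_mul ((hasDerivAt_pow (m + 1) t).div_const
      ((m + 1).factorial : ℝ)))
    refine h2.congr_deriv ?_
    rw [Nat.factorial_succ]
    push_cast
    have : (m.factorial : ℝ) ≠ 0 := by exact_mod_cast m.factorial_ne_zero
    have : (m : ℝ) + 1 ≠ 0 := by positivity
    field_simp
    ring

lemma poissonHead_antitoneOn (m : ℕ) : AntitoneOn (poissonHead (m + 1)) (Set.Ici 0) := by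
  refine antitoneOn_of_deriv_nonpos (convex_Ici 0)
    (fun t _ => (hasDerivAt_poissonHead m t).continuousAt.continuousWithinAt)
    (fun t _ => (hasDerivAt_poissonHead m t).differentiableAt.differentiableWithinAt)
    fun t ht => ?_
  rw [(hasDerivAt_poissonHead m t).deriv]
  rw [interior_Ici] at ht
  have : 0 < t := ht
  have : 0 ≤ Real.exp (-t) * (t ^ m / m.factorial) := by positivity
  linarith

lemma factorial_le_stirling {m : ℕ} (hm : 0 < m) :
    (m.factorial : ℝ) ≤ Real.exp 1 * Real.sqrt m * (m / Real.exp 1) ^ m := by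
  obtain ⟨n, rfl⟩ := Nat.exists_eq_add_one.mpr hm
  have h := Stirling.stirlingSeq'_antitone (Nat.zero_le n)
  simp only [Function.comp, Nat.succ_eq_add_one, zero_add, Stirling.stirlingSeq_one] at h
  rw [Stirling.stirlingSeq, div_le_div_iff₀ (by positivity) (by positivity),
    Real.sqrt_mul (by norm_num)] at h
  have h2 : 0 < Real.sqrt 2 := by positivity
  refine le_of_mul_le_mul_right (h.trans (le_of_eq ?_)) h2
  ring

/-- The probabilities just below the mean `m` have size `1/√m` by Stirling, and about `√m` of them
stay within a factor `2` of the largest. -/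
lemma poissonHead_nat_ge {m : ℕ} (hm : 0 < m) :
    1 / (4 * Real.exp 1) ≤ poissonHead m m := by
  have hm' : (0 : ℝ) < m := by exact_mod_cast hm
  set q : ℕ → ℝ := fun j => Real.exp (-m) * ((m : ℝ) ^ j / j.factorial) with hq
  have hq0 : ∀ j, 0 ≤ q j := fun j => by positivity
  have hstep : ∀ n, q n = q (n + 1) * ((n + 1 : ℕ) / m) := by
    intro n
    simp only [hq, Nat.factorial_succ, pow_succ]
    push_cast
    have : (n.factorial : ℝ) ≠ 0 := by exact_mod_cast n.factorial_ne_zero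
    field_simp
  have htop : 1 / (Real.exp 1 * Real.sqrt m) ≤ q (m - 1) := by
    have h1 : q (m - 1) = q m := by
      have := hstep (m - 1)
      rw [Nat.sub_add_cancel hm, div_self hm'.ne', mul_one] at this
      exact this
    rw [h1, div_le_iff₀ (by positivity)]
    have h2 := factorial_le_stirling hm
    have h3 : Real.exp (-m) = (Real.exp 1 ^ m)⁻¹ := by
      rw [Real.exp_neg, ← Real.exp_nat_mul, mul_one]
    have h4 : (0 : ℝ) < m.factorial := by exact_mod_cast m.factorial_pos
    simp only [hq]
    rw [h3]
    rw [div_pow] at h2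
    calc (1 : ℝ) = m.factorial / m.factorial := (div_self h4.ne').symm
      _ ≤ (Real.exp 1 * Real.sqrt m * (m ^ m / Real.exp 1 ^ m)) / m.factorial := by gcongr
      _ = _ := by field_simp
  -- The exact ratio is `∏_{i ≤ j} (1 - i/m)`; the linear lower bound `1 - ∑ i/m` is propagated by
  -- induction.
  have hrec : ∀ j, j < m → q (m - 1) * (1 - j * (j + 1) / (2 * m)) ≤ q (m - 1 - j) := by
    intro j
    induction j with
    | zero => intro _; simp
    | succ j ih =>
      intro hj
      have h1 := ih (by omega)
      have h2 := hstep (m - 1 - (j + 1))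
      have h3 : m - 1 - (j + 1) + 1 = m - 1 - j := by omega
      have h4 : ((m - 1 - j : ℕ) : ℝ) = m - 1 - j := by
        rw [Nat.sub_sub, Nat.cast_sub (by omega)]; push_cast; ring
      rw [h3, h4] at h2
      rw [h2]
      have h5 : (0 : ℝ) ≤ (m - 1 - j) / m := by rw [← h4]; positivity
      refine le_trans ?_ (mul_le_mul_of_nonneg_right h1 h5)
      refine le_trans (mul_le_mul_of_nonneg_left ?_ (hq0 _)) (mul_assoc _ _ _).ge
      have h6 : (1 - (j : ℝ) * (j + 1) / (2 * m)) * ((m - 1 - j) / m) -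
          (1 - ((j + 1 : ℕ) : ℝ) * ((j + 1 : ℕ) + 1) / (2 * m)) =
          (j : ℝ) * (j + 1) / (2 * m) * ((j + 1) / m) := by
        push_cast
        field_simp
        ring
      have h7 : (0 : ℝ) ≤ (j : ℝ) * (j + 1) / (2 * m) * ((j + 1) / m) := by positivity
      linarith
  set J := Nat.sqrt m with hJ
  have hJ1 : 0 < J := Nat.sqrt_pos.mpr hm
  have hJm : J ≤ m := Nat.sqrt_le_self m
  have hJ2 : J * J ≤ m := Nat.sqrt_le m
  have hJ3 : Real.sqrt m ≤ 2 * J := by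
    rw [Real.sqrt_le_left (by positivity)]
    have h1 : m < (J + 1) * (J + 1) := Nat.lt_succ_sqrt m
    have h2 : m ≤ (2 * J) ^ 2 := by nlinarith
    exact_mod_cast h2
  have hsm : 0 < Real.sqrt m := Real.sqrt_pos.mpr hm'
  calc 1 / (4 * Real.exp 1) = (Real.sqrt m / 2) * (1 / (Real.exp 1 * Real.sqrt m) * (1 / 2)) := by
        field_simp; norm_num
    _ ≤ J * (q (m - 1) * (1 / 2)) := by
        have : Real.sqrt m / 2 ≤ J := by linarith
        gcongr
    _ = ∑ j ∈ Finset.range J, q (m - 1) * (1 / 2) := by simp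
    _ ≤ ∑ j ∈ Finset.range J, q (m - 1 - j) := by
        refine Finset.sum_le_sum fun j hj => ?_
        have hj' : j + 1 ≤ J := Finset.mem_range.mp hj
        refine le_trans ?_ (hrec j (by omega))
        refine mul_le_mul_of_nonneg_left ?_ (hq0 _)
        have h1 : j * (j + 1) ≤ m := le_trans (Nat.mul_le_mul (by omega) hj') hJ2
        have h2 : (j : ℝ) * (j + 1) ≤ m := by exact_mod_cast h1
        have h3 : (j : ℝ) * (j + 1) / (2 * m) ≤ 1 / 2 := by
          rw [div_le_div_iff₀ (by positivity) (by norm_num)]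
          linarith
        linarith
    _ ≤ ∑ j ∈ Finset.range m, q (m - 1 - j) :=
        Finset.sum_le_sum_of_subset_of_nonneg (Finset.range_subset_range.mpr hJm) fun j _ _ => hq0 _
    _ = ∑ j ∈ Finset.range m, q j := Finset.sum_range_reflect q m
    _ = _ := rfl

lemma poissonHead_ge {m : ℕ} (hm : 0 < m) {t : ℝ} (ht : 0 ≤ t) (htm : t ≤ m) :
    1 / (4 * Real.exp 1) ≤ poissonHead m t := by
  refine (poissonHead_nat_ge hm).trans ?_
  obtain ⟨n, rfl⟩ := Nat.exists_eq_succ_of_ne_zero hm.ne'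
  exact poissonHead_antitoneOn n ht (ht.trans htm) htm

/-- Chernoff's bound: for `k ≤ m ≤ t` one has `t^k ≤ (t/m)^m m^k`. Writing `t/m` as the square of
`√t/√m` and using `s ≤ e^{s-1}` makes the exponent a perfect square, hence the squared distance of a
point to a disc. -/
lemma poissonHead_le {m : ℕ} (hm : 0 < m) {t : ℝ} (htm : m ≤ t) :
    poissonHead m t ≤ Real.exp (-(Real.sqrt t - Real.sqrt m) ^ 2) := by
  have hm' : (0 : ℝ) < m := by exact_mod_cast hm
  have ht : 0 < t := hm'.trans_le htm
  have h1 : 1 ≤ t / m := by rwa [one_le_div hm']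
  have ha : Real.sqrt t ^ 2 = t := Real.sq_sqrt ht.le
  have hb : Real.sqrt m ^ 2 = m := Real.sq_sqrt hm'.le
  have hb0 : 0 < Real.sqrt m := Real.sqrt_pos.mpr hm'
  have h2 : ∑ k ∈ Finset.range m, t ^ k / k.factorial ≤ (t / m) ^ m * Real.exp m := by
    calc ∑ k ∈ Finset.range m, t ^ k / k.factorial
        ≤ ∑ k ∈ Finset.range m, (t / m) ^ m * ((m : ℝ) ^ k / k.factorial) := by
          refine Finset.sum_le_sum fun k hk => ?_
          calc t ^ k / k.factorial = (t / m) ^ k * ((m : ℝ) ^ k / k.factorial) := by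
                rw [div_pow]; field_simp
            _ ≤ _ := by
                gcongr
                exact (Finset.mem_range.mp hk).le
      _ = (t / m) ^ m * ∑ k ∈ Finset.range m, (m : ℝ) ^ k / k.factorial := by
          rw [Finset.mul_sum]
      _ ≤ _ := by
          gcongr
          exact Real.sum_le_exp_of_nonneg hm'.le m
  have h3 : (t / m) ^ m ≤ Real.exp (2 * (Real.sqrt t * Real.sqrt m) - 2 * m) := by
    have h4 : t / m = (Real.sqrt t / Real.sqrt m) ^ 2 := by rw [div_pow, ha, hb]
    have h5 : Real.sqrt t / Real.sqrt m ≤ Real.exp (Real.sqrt t / Real.sqrt m - 1) := by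
      linarith [Real.add_one_le_exp (Real.sqrt t / Real.sqrt m - 1)]
    calc (t / m) ^ m = (Real.sqrt t / Real.sqrt m) ^ (2 * m) := by rw [h4, ← pow_mul]
      _ ≤ Real.exp (Real.sqrt t / Real.sqrt m - 1) ^ (2 * m) := by gcongr
      _ = _ := by
        rw [← Real.exp_nat_mul]
        congr 1
        have h6 : (m : ℝ) * (Real.sqrt t / Real.sqrt m) = Real.sqrt t * Real.sqrt m := by
          nth_rewrite 1 [← hb]
          field_simp
        push_cast
        linear_combination 2 * h6
  unfold poissonHead
  rw [← Finset.mul_sum]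
  calc Real.exp (-t) * ∑ k ∈ Finset.range m, t ^ k / k.factorial
      ≤ Real.exp (-t) * (Real.exp (2 * (Real.sqrt t * Real.sqrt m) - 2 * m) * Real.exp m) := by
        gcongr
        exact h2.trans (by gcongr)
    _ = Real.exp (-t + (2 * (Real.sqrt t * Real.sqrt m) - 2 * m + m)) := by
        rw [Real.exp_add, Real.exp_add]
    _ = _ := by
        congr 1
        rw [sub_sq, ha, hb]
        ring

/-! ### Normalized kernels as test functions. -/

lemma basisFun_coeff_pos {α : ℝ} (hα : 0 < α) (k : ℕ) :
    0 < Real.sqrt (α ^ k) / Real.sqrt (k.factorial : ℝ) := by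
  have : 0 < k.factorial := k.factorial_pos
  positivity

/-- Translating the kernel back by `w` gives a constant times `exp(α conj(z - w) ζ)`, whose Taylor
coefficients are explicit. -/
lemma enorm_innerProd_kernel {α : ℝ} (hα : 0 < α) (z w : ℂ) (k : ℕ) :
    ‖innerProd α (translate α z (basisFun α 0)) (translate α w (basisFun α k))‖ₑ ^ 2 =
      ENNReal.ofReal (Real.exp (-(α * ‖z - w‖ ^ 2)) *
        ((α * ‖z - w‖ ^ 2) ^ k / k.factorial)) := by
  set κ := Complex.exp ((α : ℂ) * conj z * w - ((α / 2 * ‖z‖ ^ 2 : ℝ) : ℂ) -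
    ((α / 2 * ‖w‖ ^ 2 : ℝ) : ℂ)) with hκ
  set d : ℕ → ℝ := fun k => Real.sqrt (α ^ k) / Real.sqrt (k.factorial : ℝ) with hd
  have hd0 : ∀ k, 0 < d k := basisFun_coeff_pos hα
  have hexp : HasExpansion α
      (fun k => κ * ((α * conj (z - w)) ^ k / k.factorial) / ((d k : ℝ) : ℂ))
      (translate α (-w) (translate α z (basisFun α 0))) := by
    intro ζ
    have h1 := (NormedSpace.expSeries_div_hasSum_exp ((α * conj (z - w)) * ζ)).mul_left κ
    rw [← Complex.exp_eq_exp_ℂ, hκ, ← Complex.exp_add] at h1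
    have h2 : translate α (-w) (translate α z (basisFun α 0)) ζ =
        Complex.exp ((α : ℂ) * conj z * w - ((α / 2 * ‖z‖ ^ 2 : ℝ) : ℂ) -
          ((α / 2 * ‖w‖ ^ 2 : ℝ) : ℂ) + (α : ℂ) * conj (z - w) * ζ) := by
      simp only [translate, basisFun, pow_zero, Nat.factorial_zero, Nat.cast_one, Real.sqrt_one,
        div_one, Complex.ofReal_one, mul_one, ← Complex.exp_add, norm_neg, map_neg, map_sub]
      congr 1
      ring
    rw [h2]
    refine h1.congr_fun fun k => ?_
    have := hd0 k
    have hne : ((d k : ℝ) : ℂ) ≠ 0 := by exact_mod_cast this.ne'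
    have hb : basisFun α k ζ = ((d k : ℝ) : ℂ) * ζ ^ k := rfl
    rw [hb, ← hκ, mul_pow]
    field_simp
  rw [innerProd_translate, hexp.innerProd_basisFun hα
    (((memFock_basisFun hα 0).translate z).translate (-w)), ← ofReal_norm,
    ← ENNReal.ofReal_pow (norm_nonneg _)]
  congr 1
  have hκn : ‖κ‖ ^ 2 = Real.exp (-(α * ‖z - w‖ ^ 2)) := by
    rw [hκ, Complex.norm_exp, ← Real.exp_nat_mul]
    congr 1
    simp only [Complex.sq_norm, Complex.normSq_apply]
    simp
    ring
  have hdk : d k ^ 2 = α ^ k / k.factorial := by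
    simp only [hd]
    rw [div_pow, Real.sq_sqrt (by positivity), Real.sq_sqrt (by positivity)]
  rw [norm_div, norm_mul, div_pow, mul_pow, hκn, Complex.norm_real, Real.norm_eq_abs, sq_abs,
    hdk, norm_div, norm_pow, norm_mul, RCLike.norm_conj, Complex.norm_real, Real.norm_eq_abs,
    abs_of_pos hα, Complex.norm_natCast]
  have : (k.factorial : ℝ) ≠ 0 := by exact_mod_cast k.factorial_ne_zero
  field_simp
  ring

lemma normSq_kernel {α : ℝ} (hα : 0 < α) (z : ℂ) :
    normSq α (translate α z (basisFun α 0)) = 1 := by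
  have := normSq_translate α (-z) (basisFun α 0)
  rw [neg_neg] at this
  rw [this, normSq_eq, lintegral_basisFun hα]

/-! ### Necessity: finite overlap and the covering. -/

namespace PlaneDivisor

variable (X : PlaneDivisor)

lemma sampleSum_kernel {α : ℝ} (hα : 0 < α) (z : ℂ) :
    X.sampleSum α (translate α z (basisFun α 0)) =
      ∑' l : X.support, ENNReal.ofReal (poissonHead (X.mult l) (α * ‖z - l‖ ^ 2)) := by
  unfold sampleSum
  refine tsum_congr fun l => ?_
  rw [poissonHead, ENNReal.ofReal_sum_of_nonneg fun k _ => by positivity]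
  exact Finset.sum_congr rfl fun k _ => enorm_innerProd_kernel hα z l k

lemma mul_radius_sq {α : ℝ} (hα : 0 < α) (l : X.support) :
    α * X.radius α l ^ 2 = X.mult l := by
  rw [radius, Real.sq_sqrt (by positivity)]
  field_simp

lemma radius_ge {α : ℝ} (hα : 0 < α) (l : X.support) : 1 / Real.sqrt α ≤ X.radius α l := by
  rw [radius, Real.sqrt_div (by positivity)]
  gcongr
  rw [Real.one_le_sqrt]
  exact_mod_cast X.mult_pos l

lemma radius_pos {α : ℝ} (hα : 0 < α) (l : X.support) : 0 < X.radius α l :=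
  lt_of_lt_of_le (by positivity) (X.radius_ge hα l)

/-- The supremum appearing in the finite overlap condition. -/
noncomputable def overlap (α : ℝ) : ℝ≥0∞ :=
  ⨆ z : ℂ, ∑' l : X.support,
    (Metric.ball (l : ℂ) (X.radius α l)).indicator (fun _ => (1 : ℝ≥0∞)) z

lemma tsum_setLIntegral_le (α : ℝ) {μ : Measure ℂ} {F : ℂ → ℝ≥0∞} (hF : Measurable F) :
    ∑' l : X.support, ∫⁻ z in Metric.ball (l : ℂ) (X.radius α l), F z ∂μ ≤
      X.overlap α * ∫⁻ z, F z ∂μ := by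
  have := X.countable_support.to_subtype
  simp_rw [← lintegral_indicator measurableSet_ball]
  rw [← lintegral_tsum fun l => (hF.indicator measurableSet_ball).aemeasurable,
    ← lintegral_const_mul _ hF]
  refine lintegral_mono fun z => ?_
  calc ∑' l : X.support, (Metric.ball (l : ℂ) (X.radius α l)).indicator F z
      = (∑' l : X.support, (Metric.ball (l : ℂ) (X.radius α l)).indicator
          (fun _ => (1 : ℝ≥0∞)) z) * F z := by
        rw [← ENNReal.tsum_mul_right]
        refine tsum_congr fun l => ?_
        simp [Set.indicator]
    _ ≤ _ := by
        gcongr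
        exact le_iSup (fun z : ℂ => ∑' l : X.support,
          (Metric.ball (l : ℂ) (X.radius α l)).indicator (fun _ => (1 : ℝ≥0∞)) z) z

lemma IsSampling.finiteOverlap {X : PlaneDivisor} {α : ℝ} (hα : 0 < α) (h : X.IsSampling α) :
    X.FiniteOverlap α := by
  obtain ⟨A, B, hA, hB, hAB⟩ := h
  set c : ℝ := 1 / (4 * Real.exp 1) with hc
  have hc0 : 0 < c := by positivity
  refine lt_of_le_of_lt (b := ENNReal.ofReal B / ENNReal.ofReal c) ?_
    (ENNReal.div_lt_top ENNReal.ofReal_ne_top (by simpa using hc0))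
  refine iSup_le fun z => ?_
  rw [ENNReal.le_div_iff_mul_le (Or.inl (by simpa using hc0)) (Or.inl ENNReal.ofReal_ne_top)]
  have h1 := (hAB _ ((memFock_basisFun hα 0).translate z)).2
  rw [normSq_kernel hα, mul_one, X.sampleSum_kernel hα] at h1
  refine le_trans ?_ h1
  rw [← ENNReal.tsum_mul_right]
  refine ENNReal.tsum_le_tsum fun l => ?_
  by_cases hz : z ∈ Metric.ball (l : ℂ) (X.radius α l)
  · rw [Set.indicator_of_mem hz, one_mul]
    refine ENNReal.ofReal_le_ofReal (poissonHead_ge (X.mult_pos l) (by positivity) ?_)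
    rw [← X.mul_radius_sq hα l]
    rw [Metric.mem_ball, dist_eq_norm] at hz
    gcongr
  · rw [Set.indicator_of_notMem hz, zero_mul]
    exact zero_le

/-- Turns the Chernoff bound at one point of the divisor into an integral over its own disc, so that
finite overlap can sum these bounds. The integral is bounded below on a disc of radius `ρ/2`
internally tangent to `D(w, r)` on the side of `z`. -/
lemma exp_mul_volume_le {α d r ρ C : ℝ} {z w : ℂ} (hα : 0 < α) (hρ : α * ρ ^ 2 = 1)
    (hρ0 : 0 < ρ) (hρr : ρ ≤ r) (hC : 0 < C) (hd : ‖z - w‖ = d) (hCd : r + C ≤ d) :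
    ENNReal.ofReal (Real.exp (-(α * (d - r) ^ 2))) * volume (Metric.ball (0 : ℂ) (ρ / 2)) ≤
      ∫⁻ u in Metric.ball w r, (Metric.ball z C)ᶜ.indicator
        (fun u => ENNReal.ofReal (Real.exp 1 * Real.exp (-(α / 2) * ‖u - z‖ ^ 2))) u := by
  have hd0 : 0 < d := by linarith
  set s : ℝ := (r - ρ / 2) / d with hs
  have hs0 : 0 ≤ s := div_nonneg (by linarith) hd0.le
  have hs1 : s ≤ 1 := by rw [hs, div_le_one hd0]; linarith
  have hsd : s * d = r - ρ / 2 := by rw [hs]; field_simp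
  set p : ℂ := w + (s : ℂ) * (z - w) with hp
  have hpw : ‖p - w‖ = r - ρ / 2 := by
    rw [hp, add_sub_cancel_left, norm_mul, hd, Complex.norm_real, Real.norm_of_nonneg hs0, hsd]
  have hpz : ‖p - z‖ = d - r + ρ / 2 := by
    have : p - z = ((s - 1 : ℝ) : ℂ) * (z - w) := by rw [hp]; push_cast; ring
    rw [this, norm_mul, hd, Complex.norm_real, Real.norm_of_nonpos (by linarith)]
    linarith
  have hvol : volume (Metric.ball (0 : ℂ) (ρ / 2)) = volume (Metric.ball p (ρ / 2)) := by
    rw [Complex.volume_ball, Complex.volume_ball]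
  rw [hvol, ← setLIntegral_const]
  calc ∫⁻ _ in Metric.ball p (ρ / 2), ENNReal.ofReal (Real.exp (-(α * (d - r) ^ 2)))
      ≤ ∫⁻ u in Metric.ball p (ρ / 2), (Metric.ball z C)ᶜ.indicator
        (fun u => ENNReal.ofReal (Real.exp 1 * Real.exp (-(α / 2) * ‖u - z‖ ^ 2))) u := by
        refine setLIntegral_mono' measurableSet_ball fun u hu => ?_
        rw [Metric.mem_ball, dist_eq_norm] at hu
        have h1 : ‖u - z‖ ≤ d - r + ρ := by
          calc ‖u - z‖ = ‖(u - p) + (p - z)‖ := by ring_nf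
            _ ≤ ‖u - p‖ + ‖p - z‖ := norm_add_le _ _
            _ ≤ _ := by rw [hpz]; linarith
        have h2 : C ≤ ‖u - z‖ := by
          have : ‖p - z‖ ≤ ‖u - p‖ + ‖u - z‖ := by
            calc ‖p - z‖ = ‖(u - z) - (u - p)‖ := by ring_nf
              _ ≤ ‖u - z‖ + ‖u - p‖ := norm_sub_le _ _
              _ = _ := add_comm _ _
          rw [hpz] at this
          linarith
        have hu' : u ∈ (Metric.ball z C)ᶜ := by
          rw [Set.mem_compl_iff, Metric.mem_ball, dist_eq_norm]; linarith
        rw [Set.indicator_of_mem hu', ← Real.exp_add]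
        refine ENNReal.ofReal_le_ofReal (Real.exp_le_exp.mpr ?_)
        -- Halving `α` in the Gaussian absorbs the `2` here, and `αρ² = 1` leaves the factor `e`.
        have h3 : ‖u - z‖ ^ 2 ≤ 2 * (d - r) ^ 2 + 2 * ρ ^ 2 := by
          have h4 : ‖u - z‖ ^ 2 ≤ (d - r + ρ) ^ 2 := by gcongr
          nlinarith [sq_nonneg (d - r - ρ)]
        nlinarith
    _ ≤ _ := by
        refine lintegral_mono_set fun u hu => ?_
        rw [Metric.mem_ball, dist_eq_norm] at hu ⊢
        calc ‖u - w‖ = ‖(u - p) + (p - w)‖ := by ring_nf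
          _ ≤ ‖u - p‖ + ‖p - w‖ := norm_add_le _ _
          _ < r := by rw [hpw]; linarith

lemma IsSampling.exists_cover {X : PlaneDivisor} {α : ℝ} (hα : 0 < α) (h : X.IsSampling α) :
    ∃ C : ℝ, 0 < C ∧
      (⋃ l : X.support, Metric.ball (l : ℂ) (X.radius α l + C)) = Set.univ := by
  have hN : X.overlap α < ⊤ := h.finiteOverlap hα
  obtain ⟨A, B, hA, hB, hAB⟩ := h
  by_contra hcon
  push Not at hcon
  have hsα : 0 < Real.sqrt α := Real.sqrt_pos.mpr hα
  set ρ : ℝ := 1 / Real.sqrt α with hρ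
  have hρ0 : 0 < ρ := by positivity
  have hαρ : α * ρ ^ 2 = 1 := by
    rw [hρ, div_pow, Real.sq_sqrt hα.le]; field_simp
  have := isProbabilityMeasure_gaussianMeasure (half_pos hα)
  set M : ℝ≥0∞ := ENNReal.ofReal (Real.exp 1 * (2 * Real.pi / α)) with hM
  have key : ∀ n : ℕ, 0 < n → ENNReal.ofReal A * volume (Metric.ball (0 : ℂ) (ρ / 2)) ≤
      X.overlap α * (M * (1 - gaussianMeasure (α / 2) (Metric.ball 0 n))) := by
    intro n hn
    have hn' : (0 : ℝ) < n := by exact_mod_cast hn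
    obtain ⟨z, hz⟩ := (Set.ne_univ_iff_exists_notMem _).mp (hcon n hn')
    simp only [Set.mem_iUnion, Metric.mem_ball, dist_eq_norm, not_exists, not_lt] at hz
    have h1 := (hAB _ ((memFock_basisFun hα 0).translate z)).1
    rw [normSq_kernel hα, mul_one, X.sampleSum_kernel hα] at h1
    set F : ℂ → ℝ≥0∞ := (Metric.ball z n)ᶜ.indicator
      (fun u => ENNReal.ofReal (Real.exp 1 * Real.exp (-(α / 2) * ‖u - z‖ ^ 2))) with hF
    have hFm : Measurable F := Measurable.indicator (by fun_prop) measurableSet_ball.compl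
    calc ENNReal.ofReal A * volume (Metric.ball (0 : ℂ) (ρ / 2))
        ≤ (∑' l : X.support, ENNReal.ofReal (poissonHead (X.mult l) (α * ‖z - l‖ ^ 2))) *
            volume (Metric.ball (0 : ℂ) (ρ / 2)) := by gcongr
      _ = ∑' l : X.support, ENNReal.ofReal (poissonHead (X.mult l) (α * ‖z - l‖ ^ 2)) *
            volume (Metric.ball (0 : ℂ) (ρ / 2)) := ENNReal.tsum_mul_right.symm
      _ ≤ ∑' l : X.support, ∫⁻ u in Metric.ball (l : ℂ) (X.radius α l), F u := by
          refine ENNReal.tsum_le_tsum fun l => ?_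
          refine le_trans ?_ (exp_mul_volume_le hα hαρ hρ0 (X.radius_ge hα l) hn' rfl (hz l))
          gcongr
          have hr := X.radius_pos hα l
          have hm := X.mul_radius_sq hα l
          have hz' := hz l
          refine (poissonHead_le (X.mult_pos l) ?_).trans (le_of_eq ?_)
          · rw [← hm]
            gcongr
            linarith
          · congr 2
            rw [← hm, Real.sqrt_mul hα.le, Real.sqrt_mul hα.le, Real.sqrt_sq (norm_nonneg _),
              Real.sqrt_sq hr.le, ← mul_sub, mul_pow, Real.sq_sqrt hα.le]
      _ ≤ X.overlap α * ∫⁻ u, F u := X.tsum_setLIntegral_le α hFm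
      _ = _ := by
          -- After recentring at `z`, the integral is `M` times the mass of the complement of the
          -- disc for the Gaussian measure of parameter `α/2`; this no longer depends on `z`.
          congr 1
          rw [← prob_compl_eq_one_sub measurableSet_ball,
            ← lintegral_indicator_one measurableSet_ball.compl, lintegral_gaussianMeasure,
            ← lintegral_add_right_eq_self F z, hM, ← mul_assoc,
            ← ENNReal.ofReal_mul (by positivity)]
          have h2 : Real.exp 1 * (2 * Real.pi / α) * (α / 2 / Real.pi) = Real.exp 1 := by
            field_simp
          rw [h2, ← lintegral_const_mul _ (by
            exact (measurable_one.indicator measurableSet_ball.compl).mul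
              (measurable_gaussian_density _))]
          refine lintegral_congr fun u => ?_
          simp only [hF, Set.indicator, Set.mem_compl_iff, Metric.mem_ball, dist_eq_norm,
            add_sub_cancel_right, sub_zero, Pi.one_apply]
          split_ifs
          · simp
          · rw [one_mul, ← ENNReal.ofReal_mul (by positivity)]
  have hlim : Tendsto (fun n : ℕ => X.overlap α *
      (M * (1 - gaussianMeasure (α / 2) (Metric.ball 0 n)))) atTop (𝓝 0) := by
    have h1 := tendsto_setLIntegral_ball (μ := gaussianMeasure (α / 2)) fun _ => 1
    simp only [one_mul, lintegral_const, measure_univ] at h1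
    have h2 : Tendsto (fun n : ℕ => 1 - gaussianMeasure (α / 2) (Metric.ball 0 (n : ℝ))) atTop
        (𝓝 0) := by
      simpa using ENNReal.Tendsto.sub (tendsto_const_nhds (x := (1 : ℝ≥0∞))) h1
        (Or.inl ENNReal.one_ne_top)
    have h3 := ENNReal.Tendsto.const_mul (a := M) h2 (Or.inr ENNReal.ofReal_ne_top)
    rw [mul_zero] at h3
    have h4 := ENNReal.Tendsto.const_mul (a := X.overlap α) h3 (Or.inr hN.ne)
    rwa [mul_zero] at h4
  have hle := ge_of_tendsto hlim ((eventually_gt_atTop 0).mono key)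
  have hpos : 0 < ENNReal.ofReal A * volume (Metric.ball (0 : ℂ) (ρ / 2)) :=
    ENNReal.mul_pos (by simpa using hA) (Metric.measure_ball_pos volume 0 (by positivity)).ne'
  exact absurd hle (not_le.mpr hpos)

end PlaneDivisor

/-! ### Upper bound, and lower bound up to a compact error. -/

lemma MemFock.hasExpansion_translate {α : ℝ} (hα : 0 < α) {f : ℂ → ℂ} (hf : MemFock α f)
    (w : ℂ) :
    HasExpansion α (fun k => innerProd α f (Fock.translate α w (basisFun α k)))
      (Fock.translate α (-w) f) := by
  simp_rw [innerProd_translate]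
  exact (hf.translate (-w)).hasExpansion hα

lemma MemFock.setLIntegral_ball {α : ℝ} (hα : 0 < α) {f : ℂ → ℂ} (hf : MemFock α f)
    (w : ℂ) (s : ℝ) :
    ∫⁻ z in Metric.ball w s, ‖f z‖ₑ ^ 2 ∂gaussianMeasure α =
      ∑' k, ‖innerProd α f (Fock.translate α w (basisFun α k))‖ₑ ^ 2 * monomialMass α k s := by
  rw [setLIntegral_translate, (hf.hasExpansion_translate hα w).setLIntegral hα]

lemma measurable_enorm_sq {f : ℂ → ℂ} (hf : Differentiable ℂ f) :
    Measurable fun z => ‖f z‖ₑ ^ 2 :=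
  hf.continuous.measurable.enorm.pow_const 2

namespace PlaneDivisor

variable (X : PlaneDivisor)

/-- The sampling sum with every multiplicity lowered by one. -/
noncomputable def reducedSum (α : ℝ) (f : ℂ → ℂ) : ℝ≥0∞ :=
  ∑' l : X.support, ∑ k ∈ Finset.range (X.mult l - 1),
    ‖innerProd α f (translate α (l : ℂ) (basisFun α k))‖ₑ ^ 2

lemma reducedSum_le_sampleSum (α : ℝ) (f : ℂ → ℂ) : X.reducedSum α f ≤ X.sampleSum α f :=
  ENNReal.tsum_le_tsum fun _ => Finset.sum_le_sum_of_subset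
    (Finset.range_subset_range.mpr (Nat.sub_le _ _))

lemma exists_sampleSum_le {α : ℝ} (hα : 0 < α) :
    ∃ B : ℝ, 0 < B ∧ ∀ f, MemFock α f →
      X.sampleSum α f ≤ ENNReal.ofReal B * (X.overlap α * normSq α f) := by
  obtain ⟨B, hB, h⟩ := exists_monomialMass_ge hα
  refine ⟨B, hB, fun f hf => ?_⟩
  rw [normSq_eq]
  refine le_trans ?_ (mul_le_mul_right (X.tsum_setLIntegral_le α (measurable_enorm_sq hf.1)) _)
  rw [← ENNReal.tsum_mul_left]
  refine ENNReal.tsum_le_tsum fun l => ?_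
  rw [hf.setLIntegral_ball hα]
  refine le_trans ?_ (mul_le_mul_right (ENNReal.sum_le_tsum (Finset.range (X.mult l))) _)
  rw [Finset.mul_sum]
  refine Finset.sum_le_sum fun k hk => ?_
  rw [mul_left_comm]
  refine le_mul_of_one_le_right' (h k _ (X.radius_pos hα l) ?_)
  rw [X.mul_radius_sq hα]
  exact_mod_cast Finset.mem_range.mp hk

lemma setLIntegral_shrink_le {α : ℝ} (hα : 0 < α) {f : ℂ → ℂ} (hf : MemFock α f)
    (l : X.support) {h : ℝ} (hh : 0 < h) :
    ∫⁻ z in Metric.ball (l : ℂ) (X.radius α l - 2 * h), ‖f z‖ₑ ^ 2 ∂gaussianMeasure α ≤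
      ∑ k ∈ Finset.range (X.mult l - 1),
        ‖innerProd α f (translate α (l : ℂ) (basisFun α k))‖ₑ ^ 2 +
      ENNReal.ofReal (Real.exp (1 - 5 * α * h ^ 2)) *
        ∫⁻ z in Metric.ball (l : ℂ) (X.radius α l), ‖f z‖ₑ ^ 2 ∂gaussianMeasure α := by
  rw [hf.setLIntegral_ball hα, hf.setLIntegral_ball hα]
  set a : ℕ → ℝ≥0∞ := fun k => ‖innerProd α f (translate α (l : ℂ) (basisFun α k))‖ₑ ^ 2 with ha
  have h1 : ∑ k ∈ Finset.range (X.mult l - 1), a k =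
      ∑' k, (if k ∈ Finset.range (X.mult l - 1) then a k else 0) := by
    rw [tsum_eq_sum (s := Finset.range (X.mult l - 1)) (fun k hk => if_neg hk)]
    exact Finset.sum_congr rfl fun k hk => (if_pos hk).symm
  rw [h1, ← ENNReal.tsum_mul_left, ← ENNReal.tsum_add]
  refine ENNReal.tsum_le_tsum fun k => ?_
  split_ifs with hk
  · refine le_add_right ?_
    exact mul_le_of_le_one_right' (monomialMass_le_one hα k _)
  -- Here `k ≥ m_λ - 1`, that is `αR² = m_λ ≤ k + 1`, just what shrinking needs. The index `m_λ - 1`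
  -- is thus treated as a high frequency, which is why one unit of multiplicity can be spared.
  · rw [zero_add, mul_left_comm]
    gcongr
    refine monomialMass_shrink hα ?_ hh
    rw [X.mul_radius_sq hα]
    rw [Finset.mem_range, not_lt] at hk
    have : X.mult l ≤ k + 1 := by omega
    exact_mod_cast this

/-- Under the hypotheses of the sufficient condition, the norm is controlled by the reduced
sampling sum and the mass on a fixed disc. -/
lemma exists_normSq_le {α : ℝ} (hα : 0 < α) (hX : X.FiniteOverlap α)
    (hcov : ∀ C : ℝ, 0 < C → ∃ K : Set ℂ, IsCompact K ∧
        (⋃ l : X.support, ⋃ _ : α * C ^ 2 < (X.mult l : ℝ),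
          Metric.ball (l : ℂ) (X.radius α l - C)) = Kᶜ) :
    ∃ ρ : ℝ, 0 < ρ ∧ ∀ f, MemFock α f → normSq α f ≤
      2 * (∫⁻ z in Metric.ball 0 ρ, ‖f z‖ₑ ^ 2 ∂gaussianMeasure α + X.reducedSum α f) := by
  have := X.countable_support.to_subtype
  have hN : X.overlap α ≠ ⊤ := ne_of_lt hX
  obtain ⟨h, hh, hε⟩ : ∃ h : ℝ, 0 < h ∧
      ENNReal.ofReal (Real.exp (1 - 5 * α * h ^ 2)) * X.overlap α ≤ 1 / 2 := by
    have h1 : Tendsto (fun h : ℝ => Real.exp (1 - 5 * α * h ^ 2)) atTop (𝓝 0) := by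
      refine Real.tendsto_exp_atBot.comp ?_
      have h2 : Tendsto (fun h : ℝ => 5 * α * h ^ 2) atTop atTop :=
        (tendsto_pow_atTop two_ne_zero).const_mul_atTop (by positivity)
      simpa [sub_eq_add_neg] using
        tendsto_atBot_add_const_left atTop 1 (tendsto_neg_atTop_atBot.comp h2)
    have h2 := ENNReal.Tendsto.mul_const (b := X.overlap α)
      (ENNReal.tendsto_ofReal h1) (Or.inr hN)
    rw [ENNReal.ofReal_zero, zero_mul] at h2
    have h3 := (h2.eventually_le_const (u := 1 / 2) (by simp)).and (eventually_gt_atTop 0)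
    obtain ⟨h, h4, h5⟩ := h3.exists
    exact ⟨h, h5, h4⟩
  obtain ⟨K, hK, hKeq⟩ := hcov (2 * h) (by positivity)
  obtain ⟨ρ, hρ0, hρ⟩ := hK.isBounded.subset_ball_lt 0 0
  refine ⟨ρ, hρ0, fun f hf => ?_⟩
  set I := ∫⁻ z in Metric.ball 0 ρ, ‖f z‖ₑ ^ 2 ∂gaussianMeasure α with hI
  set ε := ENNReal.ofReal (Real.exp (1 - 5 * α * h ^ 2)) with hεdef
  have h1 : normSq α f ≤ I + (X.reducedSum α f + 1 / 2 * normSq α f) := by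
    calc normSq α f = ∫⁻ z in Set.univ, ‖f z‖ₑ ^ 2 ∂gaussianMeasure α := by
          rw [normSq_eq, Measure.restrict_univ]
      _ ≤ ∫⁻ z in Metric.ball 0 ρ ∪ ⋃ l : X.support,
            Metric.ball (l : ℂ) (X.radius α l - 2 * h), ‖f z‖ₑ ^ 2 ∂gaussianMeasure α := by
          refine lintegral_mono_set fun z _ => ?_
          by_cases hz : z ∈ K
          · exact Or.inl (hρ hz)
          · refine Or.inr ?_
            have hz' : z ∈ Kᶜ := hz
            rw [← hKeq] at hz'
            simp only [Set.mem_iUnion] at hz' ⊢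
            obtain ⟨l, _, hl⟩ := hz'
            exact ⟨l, hl⟩
      _ ≤ I + ∑' l : X.support, ∫⁻ z in Metric.ball (l : ℂ) (X.radius α l - 2 * h),
            ‖f z‖ₑ ^ 2 ∂gaussianMeasure α :=
          (lintegral_union_le _ _ _).trans (add_le_add le_rfl (lintegral_iUnion_le _ _))
      _ ≤ I + ∑' l : X.support, (∑ k ∈ Finset.range (X.mult l - 1),
            ‖innerProd α f (translate α (l : ℂ) (basisFun α k))‖ₑ ^ 2 +
            ε * ∫⁻ z in Metric.ball (l : ℂ) (X.radius α l), ‖f z‖ₑ ^ 2 ∂gaussianMeasure α) := by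
          gcongr with l
          exact X.setLIntegral_shrink_le hα hf l hh
      _ = I + (X.reducedSum α f + ε * ∑' l : X.support,
            ∫⁻ z in Metric.ball (l : ℂ) (X.radius α l), ‖f z‖ₑ ^ 2 ∂gaussianMeasure α) := by
          rw [ENNReal.tsum_add, ENNReal.tsum_mul_left, reducedSum]
      _ ≤ I + (X.reducedSum α f + ε * (X.overlap α * normSq α f)) := by
          gcongr
          rw [normSq_eq]
          exact X.tsum_setLIntegral_le α (measurable_enorm_sq hf.1)
      _ ≤ _ := by
          rw [← mul_assoc]
          gcongr
  -- Absorbing half of the norm into the left side requires it to be finite.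
  have h2 : normSq α f / 2 ≠ ⊤ := (ENNReal.div_lt_top hf.2.ne two_ne_zero).ne
  have h3 : normSq α f / 2 ≤ I + X.reducedSum α f := by
    rw [← add_assoc, one_div, mul_comm, ← div_eq_mul_inv] at h1
    nth_rewrite 1 [← ENNReal.add_halves (normSq α f)] at h1
    exact (ENNReal.add_le_add_iff_right h2).mp h1
  calc normSq α f = 2 * (normSq α f / 2) := (ENNReal.mul_div_cancel two_ne_zero (by simp)).symm
    _ ≤ _ := by gcongr

end PlaneDivisor

/-! ### Uniqueness: vanishing orders and transfer of zeros. -/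

lemma innerProd_basisFun_eq_zero_iff {α : ℝ} (hα : 0 < α) {f : ℂ → ℂ} (hf : MemFock α f)
    (m : ℕ) :
    (∀ k < m, innerProd α f (basisFun α k) = 0) ↔ (m : ℕ∞) ≤ analyticOrderAt f 0 := by
  rw [natCast_le_analyticOrderAt_iff_iteratedDeriv_eq_zero (hf.1.analyticAt 0)]
  refine forall₂_congr fun k _ => ?_
  rw [(exists_hasExpansion hα hf.1).innerProd_basisFun hα hf]
  have h1 : ((Real.sqrt (α ^ k) / Real.sqrt (k.factorial : ℝ) : ℝ) : ℂ) ≠ 0 := by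
    exact_mod_cast (basisFun_coeff_pos hα k).ne'
  have h2 : (k.factorial : ℂ) ≠ 0 := by exact_mod_cast k.factorial_ne_zero
  rw [div_eq_zero_iff, div_eq_zero_iff, or_iff_left h1, or_iff_left h2]

lemma analyticOrderAt_translate (α : ℝ) {f : ℂ → ℂ} (hf : Differentiable ℂ f) (w : ℂ) :
    analyticOrderAt (translate α (-w) f) 0 = analyticOrderAt f w := by
  have he : Differentiable ℂ fun ζ : ℂ =>
      Complex.exp ((α : ℂ) * conj (-w) * ζ - ((α / 2 * ‖-w‖ ^ 2 : ℝ) : ℂ)) := by fun_prop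
  have hs : Differentiable ℂ fun ζ : ℂ => ζ - -w := by fun_prop
  have h1 : translate α (-w) f = (fun ζ : ℂ =>
      Complex.exp ((α : ℂ) * conj (-w) * ζ - ((α / 2 * ‖-w‖ ^ 2 : ℝ) : ℂ))) *
        (f ∘ fun ζ => ζ - -w) := rfl
  have h2 : deriv (fun ζ : ℂ => ζ - -w) 0 ≠ 0 := by simp
  rw [h1, analyticOrderAt_mul (he.analyticAt 0) ((hf.comp hs).analyticAt 0),
    analyticOrderAt_comp_of_deriv_ne_zero (hs.analyticAt 0) h2,
    (he.analyticAt 0).analyticOrderAt_eq_zero.mpr (Complex.exp_ne_zero _)]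
  simp

/-- The first `m` sampling values at `w` vanish iff `f` vanishes to order `m` at `w`. -/
lemma innerProd_translate_eq_zero_iff {α : ℝ} (hα : 0 < α) {f : ℂ → ℂ} (hf : MemFock α f)
    (w : ℂ) (m : ℕ) :
    (∀ k < m, innerProd α f (translate α w (basisFun α k)) = 0) ↔
      (m : ℕ∞) ≤ analyticOrderAt f w := by
  simp_rw [innerProd_translate]
  rw [innerProd_basisFun_eq_zero_iff hα (hf.translate (-w)), analyticOrderAt_translate α hf.1]

/-- The value at `0` of the translate of `f` is its coefficient on `e_0`, so it is at most the norm;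
undoing the translation yields the weight. -/
lemma MemFock.norm_sq_le {α : ℝ} (hα : 0 < α) {f : ℂ → ℂ} (hf : MemFock α f) (z : ℂ) :
    ‖f z‖ₑ ^ 2 ≤ ENNReal.ofReal (Real.exp (α * ‖z‖ ^ 2)) * normSq α f := by
  have hexp := (hf.translate (-z)).hasExpansion hα
  have h0 := hexp 0
  have h1 : HasSum (fun k => innerProd α (Fock.translate α (-z) f) (basisFun α k) *
      basisFun α k 0) (innerProd α (Fock.translate α (-z) f) (basisFun α 0)) := by
    have := hasSum_single (f := fun k => innerProd α (Fock.translate α (-z) f) (basisFun α k) *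
      basisFun α k 0) 0 (fun k hk => by simp [basisFun, hk])
    simpa [basisFun] using this
  have h2 := h0.unique h1
  have h3 := hexp.normSq hα
  rw [normSq_translate] at h3
  have h4 : ‖Fock.translate α (-z) f 0‖ₑ ^ 2 ≤ normSq α f := by
    rw [h2, h3]
    exact ENNReal.le_tsum 0
  have h5 := enorm_translate_sq_mul α z f 0
  simp only [norm_zero, zero_add, ne_eq, OfNat.ofNat_ne_zero, not_false_eq_true, zero_pow,
    mul_zero, Real.exp_zero, ENNReal.ofReal_one, mul_one] at h5
  rw [h5] at h4
  calc ‖f z‖ₑ ^ 2 = ENNReal.ofReal (Real.exp (α * ‖z‖ ^ 2)) *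
        (‖f z‖ₑ ^ 2 * ENNReal.ofReal (Real.exp (-α * ‖z‖ ^ 2))) := by
        rw [mul_left_comm, ← ENNReal.ofReal_mul (by positivity), ← Real.exp_add]
        simp
    _ ≤ _ := by gcongr

namespace PlaneDivisor

variable (X : PlaneDivisor)

/-- All radii are at least `1/√α`, so every point of the divisor within that distance of `z` counts
in the overlap at `z`. -/
lemma finite_support_inter_closedBall {α : ℝ} (hα : 0 < α) (hX : X.FiniteOverlap α) (M : ℝ) :
    (X.support ∩ Metric.closedBall 0 M).Finite := by
  have hρ0 : 0 < 1 / Real.sqrt α := by positivity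
  obtain ⟨t, -, ht, hcov⟩ := finite_cover_balls_of_compact
    (isCompact_closedBall (0 : ℂ) M) hρ0
  have hfin : ∀ z : ℂ, (X.support ∩ Metric.ball z (1 / Real.sqrt α)).Finite := by
    intro z
    have h1 : ∑' l : X.support, (Metric.ball (l : ℂ) (X.radius α l)).indicator
        (fun _ => (1 : ℝ≥0∞)) z ≠ ⊤ :=
      ne_top_of_le_ne_top (ne_of_lt hX) (le_iSup (fun z : ℂ => ∑' l : X.support,
        (Metric.ball (l : ℂ) (X.radius α l)).indicator (fun _ => (1 : ℝ≥0∞)) z) z)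
    refine ((ENNReal.finite_const_le_of_tsum_ne_top h1 one_ne_zero).image
      (fun l : X.support => (l : ℂ))).subset ?_
    rintro l ⟨hl, hlz⟩
    refine ⟨⟨l, hl⟩, ?_, rfl⟩
    have hz : z ∈ Metric.ball l (X.radius α ⟨l, hl⟩) := by
      rw [Metric.mem_ball'] at hlz
      rw [Metric.mem_ball]
      refine lt_of_lt_of_le ?_ (X.radius_ge hα ⟨l, hl⟩)
      rwa [dist_comm] at hlz ⊢
    simp [hz]
  refine (ht.biUnion fun z _ => hfin z).subset ?_
  rintro l ⟨hl, hlM⟩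
  obtain ⟨z, hz, hlz⟩ := Set.mem_iUnion₂.mp (hcov hlM)
  exact Set.mem_iUnion₂.mpr ⟨z, hz, hl, hlz⟩

/-- A finite divisor would cover only a bounded set, so there are infinitely many points, and local
finiteness sends them to infinity. -/
lemma exists_finset_large {α : ℝ} (hα : 0 < α) (hX : X.FiniteOverlap α) {K : Set ℂ}
    (hK : IsCompact K) (hcov : Kᶜ ⊆ ⋃ l : X.support, Metric.ball (l : ℂ) (X.radius α l))
    (M : ℝ) (n : ℕ) :
    ∃ F : Finset ℂ, ↑F ⊆ X.support ∧ F.card = n ∧ ∀ w ∈ F, M ≤ ‖w‖ := by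
  have hinf : {w ∈ X.support | M ≤ ‖w‖}.Infinite := by
    intro hfin
    have hsupp : X.support.Finite := by
      refine (hfin.union (X.finite_support_inter_closedBall hα hX M)).subset fun w hw => ?_
      rcases le_total M ‖w‖ with h | h
      · exact Or.inl ⟨hw, h⟩
      · exact Or.inr ⟨hw, by simpa using h⟩
    have := hsupp.to_subtype
    have hb : Bornology.IsBounded (⋃ l : X.support, Metric.ball (l : ℂ) (X.radius α l)) :=
      Bornology.isBounded_iUnion.mpr fun l => Metric.isBounded_ball
    refine NormedSpace.unbounded_univ ℝ ℂ ((hb.union hK.isBounded).subset fun z _ => ?_)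
    by_cases hz : z ∈ K
    · exact Or.inr hz
    · exact Or.inl (hcov hz)
  obtain ⟨F, hF, hcard⟩ := hinf.exists_subset_card_eq n
  exact ⟨F, fun w hw => (hF hw).1, hcard, fun w hw => (hF hw).2⟩

end PlaneDivisor

/-- Simple zeros can be divided out of an entire function. -/
lemma exists_div_prod (F : Finset ℂ) {f : ℂ → ℂ} (hf : Differentiable ℂ f)
    (hF : ∀ w ∈ F, f w = 0) :
    ∃ g : ℂ → ℂ, Differentiable ℂ g ∧ (∀ z, f z = g z * ∏ w ∈ F, (z - w)) ∧
      ∀ w, analyticOrderAt f w = analyticOrderAt g w + if w ∈ F then 1 else 0 := by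
  classical
  induction F using Finset.induction_on generalizing f with
  | empty => exact ⟨f, hf, by simp, by simp⟩
  | insert a s ha ih =>
    have hd : Differentiable ℂ (dslope f a) := by
      rw [← differentiableOn_univ, Complex.differentiableOn_dslope univ_mem]
      exact hf.differentiableOn
    have hfa : ∀ z, f z = (z - a) * dslope f a z := by
      intro z
      have := sub_smul_dslope f a z
      rw [hF a (Finset.mem_insert_self a s), sub_zero, smul_eq_mul] at this
      exact this.symm
    have hs : ∀ w ∈ s, dslope f a w = 0 := by
      intro w hw
      have h1 := hfa w
      rw [hF w (Finset.mem_insert_of_mem hw)] at h1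
      rcases mul_eq_zero.mp h1.symm with h2 | h2
      · rw [sub_eq_zero.mp h2] at hw
        exact absurd hw ha
      · exact h2
    obtain ⟨g, hg, hgf, hord⟩ := ih hd hs
    refine ⟨g, hg, fun z => ?_, fun w => ?_⟩
    · rw [hfa, hgf, Finset.prod_insert ha]; ring
    · have hlin : Differentiable ℂ fun z : ℂ => z - a := by fun_prop
      have h1 : f = (fun z => z - a) * dslope f a := funext hfa
      rw [h1, analyticOrderAt_mul (hlin.analyticAt w) (hd.analyticAt w), hord]
      by_cases hw : w = a
      · subst hw
        have h2 : analyticOrderAt (fun z => z - w) w = 1 :=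
          (hlin.analyticAt w).analyticOrderAt_eq_one_of_zero_deriv_ne_zero (by simp) (by simp)
        simp [h2, ha, add_comm]
      · have h2 : analyticOrderAt (fun z => z - a) w = 0 :=
          (hlin.analyticAt w).analyticOrderAt_eq_zero.mpr (sub_ne_zero.mpr hw)
        simp [h2, hw]

lemma enorm_sq_le_of_norm_le {a b : ℂ} {c : ℝ} (h : ‖a‖ ≤ c * ‖b‖) :
    ‖a‖ₑ ^ 2 ≤ ENNReal.ofReal (c ^ 2) * ‖b‖ₑ ^ 2 := by
  rw [← ofReal_norm, ← ofReal_norm, ← ENNReal.ofReal_pow (norm_nonneg _),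
    ← ENNReal.ofReal_pow (norm_nonneg _), ← ENNReal.ofReal_mul (sq_nonneg _), ← mul_pow]
  exact ENNReal.ofReal_le_ofReal (pow_le_pow_left₀ (norm_nonneg _) h 2)

lemma memFock_of_norm_le {α : ℝ} (hα : 0 < α) {f g : ℂ → ℂ} (hf : MemFock α f)
    (hg : Differentiable ℂ g) {r c : ℝ} (h : ∀ z, r ≤ ‖z‖ → ‖g z‖ ≤ c * ‖f z‖) :
    MemFock α g := by
  refine ⟨hg, ?_⟩
  rw [normSq_eq]
  calc ∫⁻ z, ‖g z‖ₑ ^ 2 ∂gaussianMeasure α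
      = ∫⁻ z in Metric.ball 0 r, ‖g z‖ₑ ^ 2 ∂gaussianMeasure α +
          ∫⁻ z in (Metric.ball 0 r)ᶜ, ‖g z‖ₑ ^ 2 ∂gaussianMeasure α :=
        (lintegral_add_compl _ measurableSet_ball).symm
    _ ≤ ∫⁻ z in Metric.ball 0 r, ‖g z‖ₑ ^ 2 ∂gaussianMeasure α +
          ENNReal.ofReal (c ^ 2) * normSq α f := by
        gcongr
        rw [normSq_eq, ← lintegral_const_mul _ (measurable_enorm_sq hf.1)]
        refine le_trans (setLIntegral_mono' measurableSet_ball.compl fun z hz => ?_)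
          (setLIntegral_le_lintegral _ _)
        refine enorm_sq_le_of_norm_le (h z ?_)
        simpa using hz
    _ < ⊤ := by
        refine ENNReal.add_lt_top.mpr ⟨?_, ENNReal.mul_lt_top ENNReal.ofReal_lt_top hf.2⟩
        rw [setLIntegral_enorm_sq hα hg.continuous]
        exact ENNReal.ofReal_lt_top

namespace PlaneDivisor

variable (X : PlaneDivisor)

lemma sampleSum_eq_zero_iff {α : ℝ} (hα : 0 < α) {f : ℂ → ℂ} (hf : MemFock α f) :
    X.sampleSum α f = 0 ↔ ∀ l : X.support, (X.mult l : ℕ∞) ≤ analyticOrderAt f l := by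
  simp only [sampleSum, ENNReal.tsum_eq_zero, Finset.sum_eq_zero_iff, Finset.mem_range,
    pow_eq_zero_iff two_ne_zero, enorm_eq_zero]
  exact forall_congr' fun l => innerProd_translate_eq_zero_iff hα hf l _

lemma reducedSum_eq_zero_iff {α : ℝ} (hα : 0 < α) {f : ℂ → ℂ} (hf : MemFock α f) :
    X.reducedSum α f = 0 ↔ ∀ l : X.support, ((X.mult l - 1 : ℕ) : ℕ∞) ≤ analyticOrderAt f l := by
  simp only [reducedSum, ENNReal.tsum_eq_zero, Finset.sum_eq_zero_iff, Finset.mem_range,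
    pow_eq_zero_iff two_ne_zero, enorm_eq_zero]
  exact forall_congr' fun l => innerProd_translate_eq_zero_iff hα hf l _

lemma norm_sq_le_of_sampleSum_eq_zero {α : ℝ} (hα : 0 < α) {ρ : ℝ} (hρ : 0 < ρ)
    (hnorm : ∀ f, MemFock α f → normSq α f ≤
      2 * (∫⁻ z in Metric.ball 0 ρ, ‖f z‖ₑ ^ 2 ∂gaussianMeasure α + X.reducedSum α f))
    (hlarge : ∀ (M : ℝ) (n : ℕ), ∃ F : Finset ℂ, ↑F ⊆ X.support ∧ F.card = n ∧
      ∀ w ∈ F, M ≤ ‖w‖)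
    {f : ℂ → ℂ} (hf : MemFock α f) (h0 : X.sampleSum α f = 0) {z₀ : ℂ} (hz₀ : 4 * ρ ≤ ‖z₀‖)
    (n : ℕ) :
    ‖f z₀‖ₑ ^ 2 ≤ ENNReal.ofReal ((1 / 4) ^ n) *
      (ENNReal.ofReal (Real.exp (α * ‖z₀‖ ^ 2)) * (2 * normSq α f)) := by
  have hord := (X.sampleSum_eq_zero_iff hα hf).mp h0
  -- The threshold is chosen so that `|z₀ - w| ≤ |z₀| + |w| ≤ 2(|w| - ρ)` for each `w ∈ F`.
  obtain ⟨F, hFX, hcard, hFM⟩ := hlarge (‖z₀‖ + 2 * ρ) n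
  have hF0 : ∀ w ∈ F, f w = 0 := by
    intro w hw
    refine apply_eq_zero_of_analyticOrderAt_ne_zero fun h => ?_
    have h1 := hord ⟨w, hFX hw⟩
    have h2 := X.mult_pos ⟨w, hFX hw⟩
    simp only at h1
    rw [h] at h1
    have h3 : X.mult ⟨w, hFX hw⟩ ≤ 0 := by exact_mod_cast h1
    omega
  obtain ⟨g₀, hg₀, hfg, hordg⟩ := exists_div_prod F hf.1 hF0
  -- One simple zero is removed at each point of `F` and a zero of order `n` placed at the origin.
  -- Growth at infinity is unchanged, and no point loses more than one order of vanishing.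
  set g : ℂ → ℂ := fun z => z ^ n * g₀ z with hg
  have hgd : Differentiable ℂ g := by fun_prop
  have hgnorm : ∀ z, ‖g z‖ * ∏ w ∈ F, ‖z - w‖ = ‖z‖ ^ n * ‖f z‖ := by
    intro z
    rw [hfg z, hg]
    simp only [norm_mul, norm_pow, norm_prod]
    ring
  have hgF : MemFock α g := by
    -- Beyond this radius `|z - w| ≥ |z|/2` for all `w ∈ F`.
    refine memFock_of_norm_le hα hf hgd (r := 2 * ∑ w ∈ F, ‖w‖ + 1) (c := 2 ^ n)
      fun z hz => ?_
    have hS : 0 ≤ ∑ w ∈ F, ‖w‖ := Finset.sum_nonneg fun _ _ => norm_nonneg _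
    have hz0 : 0 < ‖z‖ := by linarith
    have h1 : (‖z‖ / 2) ^ n ≤ ∏ w ∈ F, ‖z - w‖ := by
      rw [← hcard, ← Finset.prod_const]
      refine Finset.prod_le_prod (fun _ _ => by positivity) fun w hw => ?_
      have h2 : ‖w‖ ≤ ∑ w ∈ F, ‖w‖ :=
        Finset.single_le_sum (f := fun w : ℂ => ‖w‖) (fun _ _ => norm_nonneg _) hw
      have h3 := norm_sub_norm_le z w
      linarith
    have h4 : ‖g z‖ * (‖z‖ / 2) ^ n ≤ ‖z‖ ^ n * ‖f z‖ := by
      rw [← hgnorm z]; gcongr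
    refine le_of_mul_le_mul_right (h4.trans (le_of_eq ?_))
      (by positivity : 0 < (‖z‖ / 2) ^ n)
    rw [div_pow]
    field_simp
  have hred : X.reducedSum α g = 0 := by
    rw [X.reducedSum_eq_zero_iff hα hgF]
    intro l
    have h1 : analyticOrderAt g l = analyticOrderAt (fun z : ℂ => z ^ n) l +
        analyticOrderAt g₀ l :=
      analyticOrderAt_mul ((differentiable_id.pow n).analyticAt _) (hg₀.analyticAt _)
    have h2 : ((X.mult l - 1 : ℕ) : ℕ∞) + 1 ≤ analyticOrderAt g l + 1 := by
      have h3 : ((X.mult l - 1 : ℕ) : ℕ∞) + 1 = (X.mult l : ℕ∞) := by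
        exact_mod_cast Nat.sub_add_cancel (X.mult_pos l)
      rw [h3]
      refine (hord l).trans ?_
      rw [hordg l, h1]
      gcongr
      · exact le_add_self
      · split_ifs <;> simp
    exact (ENat.add_le_add_iff_right (by simp)).mp h2
  set Q : ℝ := ∏ w ∈ F, (‖w‖ - ρ) with hQ
  have hwρ : ∀ w ∈ F, 0 < ‖w‖ - ρ := fun w hw => by linarith [hFM w hw, norm_nonneg z₀]
  have hQ0 : 0 < Q := Finset.prod_pos hwρ
  have hinner : ∫⁻ z in Metric.ball 0 ρ, ‖g z‖ₑ ^ 2 ∂gaussianMeasure α ≤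
      ENNReal.ofReal ((ρ ^ n / Q) ^ 2) * normSq α f := by
    rw [normSq_eq, ← lintegral_const_mul _ (measurable_enorm_sq hf.1)]
    refine le_trans (setLIntegral_mono' measurableSet_ball fun z hz => ?_)
      (setLIntegral_le_lintegral _ _)
    refine enorm_sq_le_of_norm_le ?_
    have hz' : ‖z‖ < ρ := mem_ball_zero_iff.mp hz
    have h1 : Q ≤ ∏ w ∈ F, ‖z - w‖ := by
      refine Finset.prod_le_prod (fun w hw => (hwρ w hw).le) fun w _ => ?_
      have := norm_sub_norm_le w z
      rw [norm_sub_rev] at this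
      linarith
    have h2 : ‖g z‖ * Q ≤ ρ ^ n * ‖f z‖ := by
      calc ‖g z‖ * Q ≤ ‖g z‖ * ∏ w ∈ F, ‖z - w‖ := by gcongr
        _ = ‖z‖ ^ n * ‖f z‖ := hgnorm z
        _ ≤ _ := by gcongr
    rw [div_mul_eq_mul_div, le_div_iff₀ hQ0]
    exact h2
  have houter : ‖f z₀‖ ≤ Q / (2 * ρ) ^ n * ‖g z₀‖ := by
    have h1 : ∏ w ∈ F, ‖z₀ - w‖ ≤ 2 ^ n * Q := by
      rw [hQ, ← hcard, ← Finset.prod_const, ← Finset.prod_mul_distrib]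
      refine Finset.prod_le_prod (fun _ _ => norm_nonneg _) fun w hw => ?_
      have := norm_sub_le z₀ w
      linarith [hFM w hw]
    have h2 : (4 * ρ) ^ n * ‖f z₀‖ ≤ ‖g z₀‖ * (2 ^ n * Q) := by
      calc (4 * ρ) ^ n * ‖f z₀‖ ≤ ‖z₀‖ ^ n * ‖f z₀‖ := by gcongr
        _ = ‖g z₀‖ * ∏ w ∈ F, ‖z₀ - w‖ := (hgnorm z₀).symm
        _ ≤ _ := by gcongr
    have h3 : (4 * ρ) ^ n = 2 ^ n * (2 * ρ) ^ n := by rw [← mul_pow]; ring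
    rw [h3] at h2
    rw [div_mul_eq_mul_div, le_div_iff₀ (by positivity)]
    refine le_of_mul_le_mul_left ?_ (by positivity : (0 : ℝ) < 2 ^ n)
    linarith
  calc ‖f z₀‖ₑ ^ 2 ≤ ENNReal.ofReal ((Q / (2 * ρ) ^ n) ^ 2) * ‖g z₀‖ₑ ^ 2 :=
        enorm_sq_le_of_norm_le houter
    _ ≤ ENNReal.ofReal ((Q / (2 * ρ) ^ n) ^ 2) *
          (ENNReal.ofReal (Real.exp (α * ‖z₀‖ ^ 2)) *
            (2 * (ENNReal.ofReal ((ρ ^ n / Q) ^ 2) * normSq α f))) := by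
        gcongr
        refine (hgF.norm_sq_le hα z₀).trans ?_
        gcongr
        refine (hnorm g hgF).trans ?_
        rw [hred, add_zero]
        gcongr
    _ = (ENNReal.ofReal ((Q / (2 * ρ) ^ n) ^ 2) * ENNReal.ofReal ((ρ ^ n / Q) ^ 2)) *
          (ENNReal.ofReal (Real.exp (α * ‖z₀‖ ^ 2)) * (2 * normSq α f)) := by ring
    -- The unknown product `Q` cancels between the inner and outer estimates, leaving `(ρ/(2ρ))^{2n}
    -- = 4^{-n}`.
    _ = _ := by
        rw [← ENNReal.ofReal_mul (by positivity)]
        congr 2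
        have : (1 / 4 : ℝ) ^ n = (1 / 2 ^ n) ^ 2 := by
          rw [div_pow, div_pow, one_pow, one_pow, ← pow_mul, mul_comm n 2, pow_mul]
          norm_num
        rw [this, ← mul_pow, mul_pow 2 ρ n]
        congr 1
        field_simp

/-- A function in the Fock space vanishing on the divisor is zero. -/
lemma eq_zero_of_sampleSum_eq_zero {α : ℝ} (hα : 0 < α) {ρ : ℝ} (hρ : 0 < ρ)
    (hnorm : ∀ f, MemFock α f → normSq α f ≤
      2 * (∫⁻ z in Metric.ball 0 ρ, ‖f z‖ₑ ^ 2 ∂gaussianMeasure α + X.reducedSum α f))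
    (hlarge : ∀ (M : ℝ) (n : ℕ), ∃ F : Finset ℂ, ↑F ⊆ X.support ∧ F.card = n ∧
      ∀ w ∈ F, M ≤ ‖w‖)
    {f : ℂ → ℂ} (hf : MemFock α f) (h0 : X.sampleSum α f = 0) : f = 0 := by
  have hout : ∀ z : ℂ, 4 * ρ ≤ ‖z‖ → f z = 0 := by
    intro z hz
    have h1 := X.norm_sq_le_of_sampleSum_eq_zero hα hρ hnorm hlarge hf h0 hz
    have h2 : Tendsto (fun n : ℕ => ENNReal.ofReal ((1 / 4) ^ n) *
        (ENNReal.ofReal (Real.exp (α * ‖z‖ ^ 2)) * (2 * normSq α f))) atTop (𝓝 0) := by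
      have h3 := ENNReal.tendsto_ofReal
        (tendsto_pow_atTop_nhds_zero_of_lt_one (r := (1 / 4 : ℝ)) (by norm_num) (by norm_num))
      have h4 := ENNReal.Tendsto.mul_const
        (b := ENNReal.ofReal (Real.exp (α * ‖z‖ ^ 2)) * (2 * normSq α f)) h3
        (Or.inr (ENNReal.mul_ne_top ENNReal.ofReal_ne_top
          (ENNReal.mul_ne_top (by simp) hf.2.ne)))
      rwa [ENNReal.ofReal_zero, zero_mul] at h4
    have h3 := ge_of_tendsto' h2 h1
    simpa using h3
  have hfa : AnalyticOnNhd ℂ f Set.univ := fun z _ => hf.1.analyticAt z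
  refine hfa.eq_of_eventuallyEq (analyticOnNhd_const (v := (0 : ℂ)))
    (z₀ := ((5 * ρ : ℝ) : ℂ)) ?_
  have hn : 4 * ρ < ‖((5 * ρ : ℝ) : ℂ)‖ := by
    rw [Complex.norm_real, Real.norm_of_nonneg (by positivity)]; linarith
  filter_upwards [continuous_norm.continuousAt.eventually (lt_mem_nhds hn)] with z hz
  exact hout z (le_of_lt hz)

end PlaneDivisor

/-! ### Compactness and the lower sampling bound. -/

lemma normSq_const_mul {α : ℝ} (a : ℂ) {f : ℂ → ℂ} (hf : Differentiable ℂ f) :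
    normSq α (fun z => a * f z) = ‖a‖ₑ ^ 2 * normSq α f := by
  rw [normSq_eq, normSq_eq, ← lintegral_const_mul _ (measurable_enorm_sq hf)]
  simp_rw [enorm_mul, mul_pow]

lemma innerProd_const_mul (α : ℝ) (a : ℂ) (f g : ℂ → ℂ) :
    innerProd α (fun z => a * f z) g = a * innerProd α f g := by
  unfold innerProd
  simp_rw [mul_assoc a]
  rw [integral_const_mul]
  ring

lemma MemFock.const_mul {α : ℝ} {f : ℂ → ℂ} (hf : MemFock α f) (a : ℂ) :
    MemFock α (fun z => a * f z) := by
  refine ⟨hf.1.const_mul a, ?_⟩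
  rw [normSq_const_mul a hf.1]
  exact ENNReal.mul_lt_top (by simp) hf.2

lemma PlaneDivisor.sampleSum_const_mul (X : PlaneDivisor) (α : ℝ) (a : ℂ) (f : ℂ → ℂ) :
    X.sampleSum α (fun z => a * f z) = ‖a‖ₑ ^ 2 * X.sampleSum α f := by
  unfold PlaneDivisor.sampleSum
  rw [← ENNReal.tsum_mul_left]
  refine tsum_congr fun l => ?_
  rw [Finset.mul_sum]
  refine Finset.sum_congr rfl fun k _ => ?_
  rw [innerProd_const_mul, enorm_mul, mul_pow]

/-- `e_k(z) = 2^{-k} e_k(2z)`, and `e_k(2z)` is bounded in `k` by the exponential series. -/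
lemma summable_norm_basisFun {α : ℝ} (hα : 0 < α) (z : ℂ) :
    Summable fun k => ‖basisFun α k z‖ := by
  have hgeo := (summable_geometric_of_lt_one (r := (1 / 2 : ℝ)) (by norm_num) (by norm_num)).mul_left
    (Real.exp (α * ‖2 * z‖ ^ 2) + 1)
  refine Summable.of_nonneg_of_le (fun _ => norm_nonneg _) (fun k => ?_) hgeo
  have h1 : ‖basisFun α k (2 * z)‖ ^ 2 ≤ Real.exp (α * ‖2 * z‖ ^ 2) := by
    have h2 : ‖basisFun α k (2 * z)‖ ^ 2 = (α * ‖2 * z‖ ^ 2) ^ k / k.factorial := by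
      rw [basisFun, norm_mul, Complex.norm_real, Real.norm_of_nonneg (basisFun_coeff_pos hα k).le,
        mul_pow, div_pow, Real.sq_sqrt (by positivity), Real.sq_sqrt (by positivity), norm_pow,
        mul_pow, ← pow_mul, ← pow_mul, mul_comm k 2]
      ring
    rw [h2]
    exact Real.pow_div_factorial_le_exp _ (by positivity) k
  have h3 : ‖basisFun α k (2 * z)‖ ≤ Real.exp (α * ‖2 * z‖ ^ 2) + 1 := by
    nlinarith [sq_nonneg (‖basisFun α k (2 * z)‖ - 1), norm_nonneg (basisFun α k (2 * z))]
  have h4 : ‖basisFun α k z‖ = ‖basisFun α k (2 * z)‖ * (1 / 2) ^ k := by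
    simp only [basisFun, norm_mul, mul_pow, norm_pow, RCLike.norm_ofNat, one_div, inv_pow]
    field_simp
  rw [h4]
  gcongr

/-- Coefficients of functions in the unit ball lie in a product of closed unit discs, which is
sequentially compact. The series at each point is dominated by `∑ |e_k(z)|`, so coefficientwise
convergence gives pointwise convergence. -/
lemma exists_fock_limit {α : ℝ} (hα : 0 < α) {g : ℕ → ℂ → ℂ} (hg : ∀ n, MemFock α (g n))
    (hg1 : ∀ n, normSq α (g n) ≤ 1) :
    ∃ (f : ℂ → ℂ) (φ : ℕ → ℕ), StrictMono φ ∧ MemFock α f ∧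
      ∀ z, Tendsto (fun n => g (φ n) z) atTop (𝓝 (f z)) := by
  set c : ℕ → ℕ → ℂ := fun n k => innerProd α (g n) (basisFun α k) with hc
  have hexp : ∀ n, HasExpansion α (c n) (g n) := fun n => (hg n).hasExpansion hα
  have hsum : ∀ n, ∑' k, ‖c n k‖ₑ ^ 2 ≤ 1 := fun n => by
    rw [← (hexp n).normSq hα]; exact hg1 n
  have hc1 : ∀ n k, ‖c n k‖ ≤ 1 := by
    intro n k
    have h1 : ‖c n k‖ₑ ^ 2 ≤ 1 := (ENNReal.le_tsum k).trans (hsum n)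
    rw [← ofReal_norm, ← ENNReal.ofReal_pow (norm_nonneg _), ← ENNReal.ofReal_one,
      ENNReal.ofReal_le_ofReal_iff zero_le_one] at h1
    nlinarith [norm_nonneg (c n k)]
  have hcomp : IsCompact (Set.pi Set.univ fun _ : ℕ => Metric.closedBall (0 : ℂ) 1) :=
    isCompact_univ_pi fun _ => isCompact_closedBall 0 1
  obtain ⟨a, ha, φ, hφ, hlim⟩ := hcomp.tendsto_subseq (x := c)
    fun n k _ => by simpa using hc1 n k
  have ha1 : ∀ k, ‖a k‖ ≤ 1 := fun k => by simpa using ha k trivial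
  have hlimk : ∀ k, Tendsto (fun n => c (φ n) k) atTop (𝓝 (a k)) :=
    fun k => (tendsto_pi_nhds.mp hlim) k
  have hterm : ∀ (b : ℂ) (k : ℕ) (z : ℂ), ‖b‖ ≤ 1 → ‖b * basisFun α k z‖ ≤ ‖basisFun α k z‖ := by
    intro b k z hb
    rw [norm_mul]
    exact mul_le_of_le_one_left (norm_nonneg _) hb
  have hexpa : HasExpansion α a (fun z => ∑' k, a k * basisFun α k z) := fun z =>
    (Summable.of_norm_bounded (summable_norm_basisFun hα z)
      fun k => hterm _ k z (ha1 k)).hasSum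
  refine ⟨fun z => ∑' k, a k * basisFun α k z, φ, hφ, ⟨hexpa.differentiable, ?_⟩, fun z => ?_⟩
  · rw [hexpa.normSq hα]
    refine lt_of_le_of_lt ?_ ENNReal.one_lt_top
    rw [ENNReal.tsum_eq_iSup_sum]
    refine iSup_le fun s => ?_
    have h1 : Tendsto (fun n => ∑ k ∈ s, ‖c (φ n) k‖ₑ ^ 2) atTop (𝓝 (∑ k ∈ s, ‖a k‖ₑ ^ 2)) :=
      tendsto_finsetSum _ fun k _ =>
        (((ENNReal.continuous_pow 2).comp continuous_enorm).tendsto _).comp (hlimk k)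
    exact le_of_tendsto' h1 fun n => (ENNReal.sum_le_tsum s).trans (hsum (φ n))
  · have h1 : ∀ n, g (φ n) z = ∑' k, c (φ n) k * basisFun α k z :=
      fun n => (hexp (φ n) z).tsum_eq.symm
    simp_rw [h1]
    exact tendsto_tsum_of_dominated_convergence (summable_norm_basisFun hα z)
      (fun k => (hlimk k).mul_const _)
      (Eventually.of_forall fun n k => hterm _ k z (hc1 _ k))

lemma norm_le_of_normSq_le_one {α : ℝ} (hα : 0 < α) {f : ℂ → ℂ} (hf : MemFock α f)
    (h1 : normSq α f ≤ 1) {z : ℂ} {s : ℝ} (hz : ‖z‖ ≤ s) :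
    ‖f z‖ₑ ^ 2 ≤ ENNReal.ofReal (Real.exp (α * s ^ 2)) := by
  calc ‖f z‖ₑ ^ 2 ≤ ENNReal.ofReal (Real.exp (α * ‖z‖ ^ 2)) * normSq α f := hf.norm_sq_le hα z
    _ ≤ ENNReal.ofReal (Real.exp (α * s ^ 2)) * 1 := by gcongr
    _ = _ := mul_one _

lemma tendsto_setLIntegral_of_pointwise {α : ℝ} (hα : 0 < α) {g : ℕ → ℂ → ℂ} {f : ℂ → ℂ}
    (hg : ∀ n, MemFock α (g n)) (hg1 : ∀ n, normSq α (g n) ≤ 1)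
    (hlim : ∀ z, Tendsto (fun n => g n z) atTop (𝓝 (f z))) (s : ℝ) :
    Tendsto (fun n => ∫⁻ z in Metric.ball 0 s, ‖g n z‖ₑ ^ 2 ∂gaussianMeasure α) atTop
      (𝓝 (∫⁻ z in Metric.ball 0 s, ‖f z‖ₑ ^ 2 ∂gaussianMeasure α)) := by
  have := isProbabilityMeasure_gaussianMeasure hα
  refine tendsto_lintegral_of_dominated_convergence
    (fun _ => ENNReal.ofReal (Real.exp (α * s ^ 2)))
    (fun n => measurable_enorm_sq (hg n).1) (fun n => ?_) ?_ ?_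
  · filter_upwards [ae_restrict_mem measurableSet_ball] with z hz
    exact norm_le_of_normSq_le_one hα (hg n) (hg1 n) (mem_ball_zero_iff.mp hz).le
  · rw [lintegral_const]
    exact ENNReal.mul_ne_top (by simp) (measure_ne_top _ _)
  · exact Eventually.of_forall fun z =>
      (((ENNReal.continuous_pow 2).comp continuous_enorm).tendsto _).comp (hlim z)

/-- By orthogonality a coefficient can be read off from a bounded disc alone, where the unit ball is
uniformly bounded; no control at infinity is needed. -/
lemma tendsto_innerProd_basisFun {α : ℝ} (hα : 0 < α) {g : ℕ → ℂ → ℂ} {f : ℂ → ℂ}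
    (hg : ∀ n, MemFock α (g n)) (hg1 : ∀ n, normSq α (g n) ≤ 1) (hf : MemFock α f)
    (hlim : ∀ z, Tendsto (fun n => g n z) atTop (𝓝 (f z))) (k : ℕ) :
    Tendsto (fun n => innerProd α (g n) (basisFun α k)) atTop
      (𝓝 (innerProd α f (basisFun α k))) := by
  have := isProbabilityMeasure_gaussianMeasure hα
  obtain ⟨N, hN⟩ : ∃ N : ℕ, monomialMass α k N ≠ 0 :=
    ((tendsto_monomialMass hα k).eventually_ne one_ne_zero).exists
  set s : ℝ := (N : ℝ) with hs
  set J := ∫ z in Metric.ball 0 s, basisFun α k z * conj (basisFun α k z) ∂gaussianMeasure α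
    with hJ
  have hJ0 : J ≠ 0 := by
    intro h0
    rw [monomialMass, setLIntegral_enorm_sq hα (continuous_basisFun α k), ← hJ, h0] at hN
    simp at hN
  have hcoef : ∀ h, MemFock α h → innerProd α h (basisFun α k) =
      (∫ z in Metric.ball 0 s, h z * conj (basisFun α k z) ∂gaussianMeasure α) / J := by
    intro h hh
    rw [(hh.hasExpansion hα).setIntegral_mul_conj hα k s, ← hJ, mul_div_cancel_right₀ _ hJ0]
  rw [hcoef f hf]
  simp_rw [fun n => hcoef (g n) (hg n)]
  refine Tendsto.div_const ?_ J
  refine tendsto_integral_of_dominated_convergence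
    (fun _ => (Real.exp (α * s ^ 2) + 1) * ‖basisFun α k s‖) (fun n => ?_) (integrable_const _)
    (fun n => ?_) ?_
  · exact ((hg n).1.continuous.mul
      (Complex.continuous_conj.comp (continuous_basisFun α k))).aestronglyMeasurable
  · filter_upwards [ae_restrict_mem measurableSet_ball] with z hz
    have hz' := (mem_ball_zero_iff.mp hz).le
    rw [norm_mul, RCLike.norm_conj]
    refine mul_le_mul ?_ (norm_basisFun_le hz') (norm_nonneg _) (by positivity)
    have h1 := norm_le_of_normSq_le_one hα (hg n) (hg1 n) hz'
    rw [← ofReal_norm, ← ENNReal.ofReal_pow (norm_nonneg _),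
      ENNReal.ofReal_le_ofReal_iff (by positivity)] at h1
    nlinarith [sq_nonneg (‖g n z‖ - 1), norm_nonneg (g n z)]
  · exact Eventually.of_forall fun z => (hlim z).mul_const _

namespace PlaneDivisor

variable (X : PlaneDivisor)

/-- Were there no lower bound, a normalized sequence with sampling sums tending to `0` would have a
limit with zero sampling sum, hence the limit `0`. Then the mass on the fixed disc also tends to
`0`, against `hnorm`. -/
lemma exists_le_sampleSum {α : ℝ} (hα : 0 < α) {ρ : ℝ}
    (hnorm : ∀ f, MemFock α f → normSq α f ≤
      2 * (∫⁻ z in Metric.ball 0 ρ, ‖f z‖ₑ ^ 2 ∂gaussianMeasure α + X.reducedSum α f))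
    (huniq : ∀ f, MemFock α f → X.sampleSum α f = 0 → f = 0) :
    ∃ A : ℝ, 0 < A ∧ ∀ f, MemFock α f →
      ENNReal.ofReal A * normSq α f ≤ X.sampleSum α f := by
  by_contra hcon
  push Not at hcon
  have hpos : ∀ n : ℕ, (0 : ℝ) < 1 / (n + 1) := fun n => by positivity
  have hseq : ∀ n : ℕ, ∃ g, MemFock α g ∧ normSq α g = 1 ∧
      X.sampleSum α g ≤ ENNReal.ofReal (1 / (n + 1)) := by
    intro n
    obtain ⟨f, hf, hlt⟩ := hcon _ (hpos n)
    have hN0 : normSq α f ≠ 0 := by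
      intro h
      rw [h, mul_zero] at hlt
      exact not_lt_zero hlt
    have hNt : normSq α f ≠ ⊤ := hf.2.ne
    set a : ℂ := ((Real.sqrt ((normSq α f).toReal)⁻¹ : ℝ) : ℂ) with ha
    have hscale : ‖a‖ₑ ^ 2 * normSq α f = 1 := by
      have hr : 0 < (normSq α f).toReal := ENNReal.toReal_pos hN0 hNt
      rw [ha, ← ofReal_norm, Complex.norm_real, Real.norm_of_nonneg (Real.sqrt_nonneg _),
        ← ENNReal.ofReal_pow (Real.sqrt_nonneg _), Real.sq_sqrt (by positivity),
        ENNReal.ofReal_inv_of_pos hr, ENNReal.ofReal_toReal hNt, ENNReal.inv_mul_cancel hN0 hNt]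
    refine ⟨fun z => a * f z, hf.const_mul a, ?_, ?_⟩
    · rw [normSq_const_mul a hf.1, hscale]
    · rw [X.sampleSum_const_mul]
      calc ‖a‖ₑ ^ 2 * X.sampleSum α f
          ≤ ‖a‖ₑ ^ 2 * (ENNReal.ofReal (1 / (n + 1)) * normSq α f) := by gcongr
        _ = _ := by rw [mul_left_comm, hscale, mul_one]
  choose g hg hg1 hgS using hseq
  obtain ⟨f, φ, hφ, hf, hlim⟩ := exists_fock_limit hα hg fun n => (hg1 n).le
  have hS : Tendsto (fun n => X.sampleSum α (g (φ n))) atTop (𝓝 0) := by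
    have h1 := ENNReal.tendsto_ofReal (tendsto_one_div_add_atTop_nhds_zero_nat (𝕜 := ℝ))
    rw [ENNReal.ofReal_zero] at h1
    exact tendsto_of_tendsto_of_tendsto_of_le_of_le tendsto_const_nhds
      (h1.comp hφ.tendsto_atTop) (fun _ => zero_le) fun n => hgS (φ n)
  have hSf : X.sampleSum α f = 0 := by
    simp only [sampleSum, ENNReal.tsum_eq_zero, Finset.sum_eq_zero_iff, Finset.mem_range]
    intro l k hk
    have h1 : Tendsto (fun n => innerProd α (g (φ n)) (translate α l (basisFun α k))) atTop
        (𝓝 (innerProd α f (translate α l (basisFun α k)))) := by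
      simp_rw [innerProd_translate]
      refine tendsto_innerProd_basisFun hα (fun n => (hg (φ n)).translate (-l)) (fun n => ?_)
        (hf.translate (-l)) (fun z => ?_) k
      · rw [normSq_translate, hg1]
      · exact (hlim (z - -l)).const_mul _
    have h2 := (((ENNReal.continuous_pow 2).comp continuous_enorm).tendsto _).comp h1
    refine tendsto_nhds_unique h2 (tendsto_of_tendsto_of_tendsto_of_le_of_le tendsto_const_nhds hS
      (fun _ => zero_le) fun n => ?_)
    refine le_trans ?_ (ENNReal.le_tsum l)
    exact Finset.single_le_sum (f := fun k =>
      ‖innerProd α (g (φ n)) (translate α l (basisFun α k))‖ₑ ^ 2) (fun _ _ => zero_le)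
      (Finset.mem_range.mpr hk)
  have hf0 := huniq f hf hSf
  have hball := tendsto_setLIntegral_of_pointwise hα (fun n => hg (φ n))
    (fun n => (hg1 (φ n)).le) hlim ρ
  rw [hf0] at hball
  simp only [Pi.zero_apply, enorm_zero, ne_eq, OfNat.ofNat_ne_zero, not_false_eq_true, zero_pow,
    lintegral_const, zero_mul] at hball
  have h1 := ENNReal.Tendsto.const_mul (a := 2) (hball.add hS) (Or.inr (by simp))
  rw [add_zero, mul_zero] at h1
  have h2 : (1 : ℝ≥0∞) ≤ 0 := ge_of_tendsto' h1 fun n => by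
    rw [← hg1 (φ n)]
    refine (hnorm _ (hg (φ n))).trans ?_
    gcongr
    exact X.reducedSum_le_sampleSum α _
  exact absurd h2 (by simp)

/-- Finite overlap and covering by the shrunken discs outside compact sets imply sampling. -/
lemma isSampling_of_cover {α : ℝ} (hα : 0 < α) (hX : X.FiniteOverlap α)
    (hcov : ∀ C : ℝ, 0 < C → ∃ K : Set ℂ, IsCompact K ∧
        (⋃ l : X.support, ⋃ _ : α * C ^ 2 < (X.mult l : ℝ),
          Metric.ball (l : ℂ) (X.radius α l - C)) = Kᶜ) :
    X.IsSampling α := by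
  obtain ⟨ρ, hρ, hnorm⟩ := X.exists_normSq_le hα hX hcov
  obtain ⟨K, hK, hKeq⟩ := hcov 1 one_pos
  have hlarge := X.exists_finset_large hα hX hK (by
    rw [← hKeq]
    refine Set.iUnion_mono fun l => Set.iUnion_subset fun _ => Metric.ball_subset_ball ?_
    linarith)
  obtain ⟨A, hA, hlow⟩ := X.exists_le_sampleSum hα hnorm fun f hf h0 =>
    X.eq_zero_of_sampleSum_eq_zero hα hρ hnorm hlarge hf h0
  obtain ⟨B, hB, hup⟩ := X.exists_sampleSum_le hα
  have hN : X.overlap α ≠ ⊤ := ne_of_lt hX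
  -- The added `1` keeps the constant positive whatever the overlap is.
  refine ⟨A, B * ((X.overlap α).toReal + 1), hA, by positivity, fun f hf =>
    ⟨hlow f hf, (hup f hf).trans ?_⟩⟩
  rw [ENNReal.ofReal_mul hB.le, mul_assoc]
  gcongr
  rw [ENNReal.ofReal_add ENNReal.toReal_nonneg zero_le_one, ENNReal.ofReal_toReal hN]
  exact le_self_add

end PlaneDivisor

end Fock

theorem theorem1 (α : ℝ) (hα : 0 < α) (X : Fock.PlaneDivisor) :
    (X.IsSampling α →
      X.FiniteOverlap α ∧
        ∃ C : ℝ, 0 < C ∧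
          (⋃ l : X.support, Metric.ball (l : ℂ) (X.radius α l + C)) = Set.univ) ∧
    (X.FiniteOverlap α →
      (∀ C : ℝ, 0 < C → ∃ K : Set ℂ, IsCompact K ∧
        (⋃ l : X.support, ⋃ _ : α * C ^ 2 < (X.mult l : ℝ),
          Metric.ball (l : ℂ) (X.radius α l - C)) = Kᶜ) →
      X.IsSampling α) :=
  ⟨fun h => ⟨h.finiteOverlap hα, h.exists_cover hα⟩,
    fun hX hcov => X.isSampling_of_cover hα hX hcov⟩
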